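/- **Theorem (Self-normalized estimation error).** Consider the linear system $$x_{t+1}=Ax_t+Bu_t+w_t,\qquad y_t=Cx_t+z_t,\qquad t\ge 0,$$ with $x_t\in\mathbb R^n$, $u_t\in\mathbb R^p$, $y_t\in\mathbb R^m$, independent noises $w_t\sim\mathcal N(0,\sigma_w^2I)$, $z_t\sim\mathcal N(0,\sigma_z^2I)$, $\sigma_w,\sigma_z>0$, and independent initial state $x_0\sim\mathcal N(0,\Sigma)$, where $\Sigma\succeq0$ solves $$\Sigma=A\Sigma A^\top-A\Sigma C^\top(C\Sigma C^\top+\sigma_z^2I)^{-1}C\Sigma A^\top+\sigma_w^2I .$$ The data may be collected in closed loop: $u_t$ is any measurable function of $y_0,\dots,y_t$ and of randomization of the agent that is independent of $(x_0,(w_t)_t,(z_t)_t)$. Let $F=A\Sigma C^\top(C\Sigma C^\top+\sigma_z^2I)^{-1}$ and $\bar A=A-FC$, and let $\hat x_0=0$, $\hat x_{t+1}=\bar A\hat x_t+Bu_t+Fy_t$ be the predictor state. For an integer $H_e\ge1$ put $$\mathcal G_y=[\,CF,\ C\bar AF,\dots,C\bar A^{H_e-1}F,\ CB,\ C\bar AB,\dots,C\bar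 A^{H_e-1}B\,],\qquad \phi_t=[\,y_{t-1}^\top\dots y_{t-H_e}^\top\ u_{t-1}^\top\dots u_{t-H_e}^\top]^\top .$$ For $\lambda>0$ let $$V_t=\lambda I+\sum_{i=H_e}^{t}\phi_i\phi_i^\top,\qquad \widehat{\mathcal G}_{t}=\arg\min_X\ \lambda\|X\|_F^2+\sum_{i=H_e}^{t}\|y_i-X\phi_i\|_2^2 .$$ Then $\bar A$ is stable: there are an invertible matrix $P$ and $\upsilon\in(0,1)$ with $\|P\bar AP^{-1}\|_2\le\upsilon$. For every such $P,\upsilon$ and all $\Upsilon,\mathcal X\in\mathbb R$ there is a constant $c_H>0$, depending only on the system, $P$, $\upsilon$, $\Upsilon$ and $\mathcal X$, with the following property. Let $\tau\le T$, $\delta\in(0,1)$, $\|\mathcal G_y\|_F\le S$, and let $$H_e\ \ge\ \frac{\log\!\big(c_HT^2\sqrt m/\sqrt\lambda\big)}{\log(1/\upsilon)} .$$ Then, with probability at least $1-\delta$, the following implication holds: if $\|\phi_t\|_2\le\Upsilon\sqrt{H_e}$ and $\|\hat x_{t-H_e}\|_2\le\mathcal X$ for all $H_e\le t\le\tau$,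 then for all $t\le s\le\tau$ $$\operatorname{Tr}\big((\widehat{\mathcal G}_{s}-\mathcal G_y)V_t(\widehat{\mathcal G}_{s}-\mathcal G_y)^\top\big)\le\beta_s,$$ $$\beta_s=\left(\sqrt{2m\,\|C\Sigma C^\top+\sigma_z^2I\|_2\,\log\frac{\det(V_s)^{1/2}}{\delta\,\det(\lambda I)^{1/2}}}+S\sqrt\lambda+\frac{s\sqrt{H_e}}{T^2}\right)^{2}.$$ In particular (for $s=\tau$) $\mathcal G_y$ lies in the ellipsoid of radius $\beta_\tau$ around $\widehat{\mathcal G}_\tau$ with respect to every $V_t$, $t\le\tau$. -/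

import Mathlib

open MeasureTheory ProbabilityTheory
open scoped Matrix

noncomputable section

namespace PredictorLS

/-- Spectral norm of a square real matrix (operator norm for the Euclidean norm). -/
def specNorm {k : ℕ} (M : Matrix (Fin k) (Fin k) ℝ) : ℝ :=
  ‖Matrix.toEuclideanCLM (𝕜 := ℝ) M‖

/-- Frobenius norm of a real matrix. -/
def frobNorm {ι κ : Type*} [Fintype ι] [Fintype κ] (M : Matrix ι κ ℝ) : ℝ :=
  Real.sqrt (∑ i, ∑ j, M i j ^ 2)

/-- The innovation covariance `C Σ Cᵀ + σ_z² I`. -/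
def innovCov {n m : ℕ} (C : Matrix (Fin m) (Fin n) ℝ) (σz : ℝ)
    (Sig : Matrix (Fin n) (Fin n) ℝ) : Matrix (Fin m) (Fin m) ℝ :=
  C * Sig * Cᵀ + σz ^ 2 • (1 : Matrix (Fin m) (Fin m) ℝ)

/-- `Sig` solves the discrete algebraic Riccati equation of the filter:
`Σ = A Σ Aᵀ - A Σ Cᵀ (C Σ Cᵀ + σ_z² I)⁻¹ C Σ Aᵀ + σ_w² I`. -/
def IsDARESolution {n m : ℕ} (A : Matrix (Fin n) (Fin n) ℝ) (C : Matrix (Fin m) (Fin n) ℝ)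
    (σw σz : ℝ) (Sig : Matrix (Fin n) (Fin n) ℝ) : Prop :=
  Sig = A * Sig * Aᵀ - A * Sig * Cᵀ * (innovCov C σz Sig)⁻¹ * C * Sig * Aᵀ
    + σw ^ 2 • (1 : Matrix (Fin n) (Fin n) ℝ)

/-- The Kalman gain in observer form, `F = A Σ Cᵀ (C Σ Cᵀ + σ_z² I)⁻¹`. -/
def kalmanGain {n m : ℕ} (A : Matrix (Fin n) (Fin n) ℝ) (C : Matrix (Fin m) (Fin n) ℝ)
    (σz : ℝ) (Sig : Matrix (Fin n) (Fin n) ℝ) : Matrix (Fin n) (Fin m) ℝ :=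
  A * Sig * Cᵀ * (innovCov C σz Sig)⁻¹

/-- The predictor matrix `Ā = A - F C`. -/
def Abar {n m : ℕ} (A : Matrix (Fin n) (Fin n) ℝ) (C : Matrix (Fin m) (Fin n) ℝ)
    (σz : ℝ) (Sig : Matrix (Fin n) (Fin n) ℝ) : Matrix (Fin n) (Fin n) ℝ :=
  A - kalmanGain A C σz Sig * C

/-- Index set of the `(m + p) H` coordinates of the regressor: `H` blocks of outputs, followed by
`H` blocks of inputs. Block number `k` (from `0`) belongs to time lag `k + 1`. -/
abbrev RegIdx (m p H : ℕ) : Type := (Fin H × Fin m) ⊕ (Fin H × Fin p)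

/-- The predictor-form parameter
`G_y = [C F, C Ā F, …, C Ā^(H-1) F, C B, C Ā B, …, C Ā^(H-1) B]`. -/
def Gy {n m p : ℕ} (A : Matrix (Fin n) (Fin n) ℝ) (B : Matrix (Fin n) (Fin p) ℝ)
    (C : Matrix (Fin m) (Fin n) ℝ) (σz : ℝ) (Sig : Matrix (Fin n) (Fin n) ℝ) (H : ℕ) :
    Matrix (Fin m) (RegIdx m p H) ℝ :=
  fun i => Sum.elim
    (fun kj => (C * Abar A C σz Sig ^ (kj.1 : ℕ) * kalmanGain A C σz Sig) i kj.2)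
    (fun kj => (C * Abar A C σz Sig ^ (kj.1 : ℕ) * B) i kj.2)

/-- The regressor `φ_t = [y_{t-1}ᵀ … y_{t-H}ᵀ u_{t-1}ᵀ … u_{t-H}ᵀ]ᵀ` (used for `t ≥ H` only). -/
def regressor {m p : ℕ} (H : ℕ) (y : ℕ → EuclideanSpace ℝ (Fin m))
    (u : ℕ → EuclideanSpace ℝ (Fin p)) (t : ℕ) : EuclideanSpace ℝ (RegIdx m p H) :=
  WithLp.toLp 2 (Sum.elim
    (fun kj => y (t - 1 - (kj.1 : ℕ)) kj.2) (fun kj => u (t - 1 - (kj.1 : ℕ)) kj.2))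

/-- The regularized design matrix `V_t = lam I + ∑_{i=H}^{t} φ_i φ_iᵀ`. -/
def designMatrix {m p : ℕ} (H : ℕ) (lam : ℝ) (y : ℕ → EuclideanSpace ℝ (Fin m))
    (u : ℕ → EuclideanSpace ℝ (Fin p)) (t : ℕ) :
    Matrix (RegIdx m p H) (RegIdx m p H) ℝ :=
  lam • (1 : Matrix (RegIdx m p H) (RegIdx m p H) ℝ) + ∑ i ∈ Finset.Icc H t,
    Matrix.vecMulVec (WithLp.ofLp (regressor H y u i)) (WithLp.ofLp (regressor H y u i))

/-- The regularized least-squares objective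
`X ↦ lam ‖X‖_F² + ∑_{i=H}^{t} ‖y_i - X φ_i‖₂²`. -/
def rlsLoss {m p : ℕ} (H : ℕ) (lam : ℝ) (y : ℕ → EuclideanSpace ℝ (Fin m))
    (u : ℕ → EuclideanSpace ℝ (Fin p)) (t : ℕ) (X : Matrix (Fin m) (RegIdx m p H) ℝ) : ℝ :=
  lam * frobNorm X ^ 2 + ∑ i ∈ Finset.Icc H t,
    ‖y i - WithLp.toLp 2 (X *ᵥ WithLp.ofLp (regressor H y u i))‖ ^ 2

/-- The state of the steady-state Kalman predictor, `x̂_0 = 0` and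
`x̂_{t+1} = Ā x̂_t + B u_t + F y_t`. -/
def predictorState {n m p : ℕ} (A : Matrix (Fin n) (Fin n) ℝ) (B : Matrix (Fin n) (Fin p) ℝ)
    (C : Matrix (Fin m) (Fin n) ℝ) (σz : ℝ) (Sig : Matrix (Fin n) (Fin n) ℝ)
    (y : ℕ → EuclideanSpace ℝ (Fin m)) (u : ℕ → EuclideanSpace ℝ (Fin p)) :
    ℕ → EuclideanSpace ℝ (Fin n)
  | 0 => 0
  | t + 1 => WithLp.toLp 2 (
      Abar A C σz Sig *ᵥ WithLp.ofLp (predictorState A B C σz Sig y u t)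
        + B *ᵥ WithLp.ofLp (u t) + kalmanGain A C σz Sig *ᵥ WithLp.ofLp (y t))

/-- The confidence radius
`β_t = (√(2 m ‖C Σ Cᵀ + σ_z² I‖ log (det(V_t)^(1/2) / (δ det(lam I)^(1/2)))) + S √lam
  + t √H / T²)²`, as a function of the design matrix `V = V_t`. -/
def beta {n m p : ℕ} (C : Matrix (Fin m) (Fin n) ℝ) (σz : ℝ) (Sig : Matrix (Fin n) (Fin n) ℝ)
    (H T : ℕ) (lam S δ : ℝ) (V : Matrix (RegIdx m p H) (RegIdx m p H) ℝ) (t : ℕ) : ℝ :=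
  (Real.sqrt (2 * (m : ℝ) * specNorm (innovCov C σz Sig) *
      Real.log (Real.sqrt V.det /
        (δ * Real.sqrt (lam • (1 : Matrix (RegIdx m p H) (RegIdx m p H) ℝ)).det)))
    + S * Real.sqrt lam + (t : ℝ) * Real.sqrt (H : ℝ) / (T : ℝ) ^ 2) ^ 2

/-- The sources of randomness: the agent's own randomization, the initial state, the process noise
and the measurement noise of every time step. -/
inductive Source
  | agent
  | init
  | process (t : ℕ)
  | meas (t : ℕ)

/-- The σ-algebra generated by each source of randomness. -/
@[reducible] def sourceSigma {Ω : Type*} {n m : ℕ} (𝒢 : MeasurableSpace Ω)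
    (x0 : Ω → EuclideanSpace ℝ (Fin n)) (w : ℕ → Ω → EuclideanSpace ℝ (Fin n))
    (z : ℕ → Ω → EuclideanSpace ℝ (Fin m)) : Source → MeasurableSpace Ω
  | .agent => 𝒢
  | .init => MeasurableSpace.comap x0 inferInstance
  | .process t => MeasurableSpace.comap (w t) inferInstance
  | .meas t => MeasurableSpace.comap (z t) inferInstance

/-- `x, u, y, w, z` are the states, inputs, outputs and noises of the system
`x_{t+1} = A x_t + B u_t + w_t`, `y_t = C x_t + z_t`, started at the steady state `x_0 ∼ N(0, Σ)`,
with independent noises `w_t ∼ N(0, σ_w² I)` and `z_t ∼ N(0, σ_z² I)`. The input `u_t` is any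
measurable function of the outputs `y_0, …, y_t` and of the agent's own randomization, which is
carried by a σ-algebra `𝒢` independent of the system. So the data may be collected in open loop
or in closed loop. -/
structure IsClosedLoopData {Ω : Type*} (𝒢 : MeasurableSpace Ω) {mΩ : MeasurableSpace Ω}
    (μ : Measure Ω) {n m p : ℕ} (A : Matrix (Fin n) (Fin n) ℝ) (B : Matrix (Fin n) (Fin p) ℝ)
    (C : Matrix (Fin m) (Fin n) ℝ) (σw σz : ℝ) (Sig : Matrix (Fin n) (Fin n) ℝ)
    (x : ℕ → Ω → EuclideanSpace ℝ (Fin n)) (u : ℕ → Ω → EuclideanSpace ℝ (Fin p))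
    (y : ℕ → Ω → EuclideanSpace ℝ (Fin m)) (w : ℕ → Ω → EuclideanSpace ℝ (Fin n))
    (z : ℕ → Ω → EuclideanSpace ℝ (Fin m)) : Prop where
  agent_le : 𝒢 ≤ mΩ
  measurable_init : Measurable[mΩ] (x 0)
  measurable_process : ∀ t, Measurable[mΩ] (w t)
  measurable_meas : ∀ t, Measurable[mΩ] (z t)
  law_init : HasLaw (x 0) (multivariateGaussian 0 Sig) μ
  law_process : ∀ t, HasLaw (w t)
    (multivariateGaussian 0 (σw ^ 2 • (1 : Matrix (Fin n) (Fin n) ℝ))) μ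
  law_meas : ∀ t, HasLaw (z t)
    (multivariateGaussian 0 (σz ^ 2 • (1 : Matrix (Fin m) (Fin m) ℝ))) μ
  indep : iIndep (sourceSigma 𝒢 (x 0) w z) μ
  state_eq : ∀ t ω, x (t + 1) ω = WithLp.toLp 2
    (A *ᵥ WithLp.ofLp (x t ω) + B *ᵥ WithLp.ofLp (u t ω) + WithLp.ofLp (w t ω))
  output_eq : ∀ t ω, y t ω = WithLp.toLp 2 (C *ᵥ WithLp.ofLp (x t ω) + WithLp.ofLp (z t ω))
  input_causal : ∀ t,
    Measurable[𝒢 ⊔ ⨆ s : Fin (t + 1), MeasurableSpace.comap (y s) inferInstance] (u t)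

end PredictorLS

end

/-! The argument has three independent ingredients: the innovations are fresh Gaussian noise even in
closed loop, Gaussian noise weighted by predictable regressors has a self-normalized tail bound, and
regularized least squares is stable under a small bias.

Filtering. The prediction error `x_t - x̂_t` obeys a recursion in which the inputs cancel, so
feedback cannot affect it. By the Riccati equation, one step sends an error with law `N(0, Σ)` to a
new error with the same law, independent of the innovation `e_t = C (x_t - x̂_t) + z_t`. By
induction each error is independent of the agent's randomization and of the earlier innovations;
hence `e_t` is `N(0, C Σ Cᵀ + σ_z² I)` and independent of that past
(`IsErrorRecursion.law_innovation_and_indep`). All data before time `t` are functions of that past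
(`IsClosedLoopData.measurable_data`), so the regressors are predictable.

Concentration. For each output coordinate, `mixtureWeight` is a nonnegative martingale started at 1.
Adding the martingales of the `m` coordinates, applying Ville's inequality to the sum and then
Jensen's inequality for `exp` gives `measure_selfNormalized_le`, uniformly in time. Independence
between the coordinates is not needed.

Least squares. Unrolling the predictor gives `y_t = G_y φ_t + b_t + e_t`, where `b_t = C Ā^H
x̂_{t-H}` is exponentially small in `H`. Testing the normal equation against the estimation error
`D` bounds `W = tr (D V_s Dᵀ)` by `√W` times the sum of a noise, a regularization and a bias term
(`trace_le_of_rls`). The lower bound on `H_e` makes the bias at most `s √H_e / T²`.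

Stability comes from the Joseph form of the Riccati equation: in coordinates where `Σ` is the
identity, it exhibits `Ā` as a strict contraction (`exists_specNorm_conj_Abar_lt_one`). -/

namespace PredictorLS

/-! ### Rank-one updates of positive definite matrices. -/

section LinearAlgebra

variable {ι : Type*} [Fintype ι]

theorem posDef_add_vecMulVec_self {V : Matrix ι ι ℝ} (hV : V.PosDef) (φ : ι → ℝ) :
    (V + Matrix.vecMulVec φ φ).PosDef :=
  hV.add_posSemidef (by simpa using Matrix.posSemidef_vecMulVec_self_star φ)

theorem dotProduct_mulVec_comm_of_isHermitian {V : Matrix ι ι ℝ} (hV : V.IsHermitian)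
    (x y : ι → ℝ) : x ⬝ᵥ V *ᵥ y = y ⬝ᵥ V *ᵥ x := by
  have h : Vᵀ = V := by simpa [Matrix.conjTranspose_eq_transpose_of_trivial] using hV.eq
  rw [Matrix.dotProduct_mulVec, ← Matrix.mulVec_transpose, h, dotProduct_comm]

variable [DecidableEq ι]

/-- Matrix determinant lemma. Together with `inv_quadForm_rankOne_update` it yields the one-step
ratio of the mixture process. -/
theorem det_add_vecMulVec_self {V : Matrix ι ι ℝ} (hV : V.PosDef) (φ : ι → ℝ) :
    (V + Matrix.vecMulVec φ φ).det = V.det * (1 + φ ⬝ᵥ V⁻¹ *ᵥ φ) := by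
  rw [Matrix.vecMulVec_eq Unit, Matrix.det_add_replicateCol_mul_replicateRow
    (hV.det_pos.ne'.isUnit)]
  congr 2
  simp [Matrix.det_unique, Matrix.mul_apply, dotProduct, Matrix.mulVec, Finset.sum_mul,
    Finset.mul_sum, mul_assoc]
  rw [Finset.sum_comm]

theorem dotProduct_inv_mulVec_nonneg {V : Matrix ι ι ℝ} (hV : V.PosDef) (φ : ι → ℝ) :
    0 ≤ φ ⬝ᵥ V⁻¹ *ᵥ φ := by
  simpa using hV.inv.posSemidef.dotProduct_mulVec_nonneg φ

theorem mulVec_inv_cancel_of_posDef {V : Matrix ι ι ℝ} (hV : V.PosDef) (x : ι → ℝ) :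
    V *ᵥ (V⁻¹ *ᵥ x) = x := by
  rw [Matrix.mulVec_mulVec, Matrix.mul_nonsing_inv _ hV.det_pos.ne'.isUnit, Matrix.one_mulVec]

/-- Rank-one update of the self-normalized quadratic form. -/
theorem inv_quadForm_rankOne_update {V : Matrix ι ι ℝ} (hV : V.PosDef) (φ S : ι → ℝ) (η : ℝ) :
    (S + η • φ) ⬝ᵥ (V + Matrix.vecMulVec φ φ)⁻¹ *ᵥ (S + η • φ) =
      S ⬝ᵥ V⁻¹ *ᵥ S + (2 * (φ ⬝ᵥ V⁻¹ *ᵥ S) * η + (φ ⬝ᵥ V⁻¹ *ᵥ φ) * η ^ 2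
        - (φ ⬝ᵥ V⁻¹ *ᵥ S) ^ 2) / (1 + φ ⬝ᵥ V⁻¹ *ᵥ φ) := by
  have hq := dotProduct_inv_mulVec_nonneg hV φ
  have hsym := dotProduct_mulVec_comm_of_isHermitian hV.inv.isHermitian S φ
  set q := φ ⬝ᵥ V⁻¹ *ᵥ φ with hqdef
  set a := φ ⬝ᵥ V⁻¹ *ᵥ S with hadef
  have hW := posDef_add_vecMulVec_self hV φ
  -- Sherman–Morrison without inverting: the right-hand side is checked to solve the linear system
  -- of the updated matrix.
  have key : (V + Matrix.vecMulVec φ φ)⁻¹ *ᵥ (S + η • φ) =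
      V⁻¹ *ᵥ S + ((η - a) / (1 + q)) • (V⁻¹ *ᵥ φ) := by
    have h1 : (V + Matrix.vecMulVec φ φ) *ᵥ
        (V⁻¹ *ᵥ S + ((η - a) / (1 + q)) • (V⁻¹ *ᵥ φ)) = S + η • φ := by
      rw [Matrix.add_mulVec, Matrix.mulVec_add, Matrix.mulVec_smul, mulVec_inv_cancel_of_posDef hV,
        mulVec_inv_cancel_of_posDef hV, Matrix.vecMulVec_mulVec, dotProduct_add, dotProduct_smul,
        ← hqdef, ← hadef]
      ext i
      simp only [Pi.add_apply, Pi.smul_apply, smul_eq_mul, op_smul_eq_smul]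
      field_simp
      ring
    rw [← h1, Matrix.mulVec_mulVec, Matrix.nonsing_inv_mul _ hW.det_pos.ne'.isUnit,
      Matrix.one_mulVec]
  rw [key]
  simp only [dotProduct_add, add_dotProduct, dotProduct_smul, smul_dotProduct, smul_eq_mul]
  rw [hsym, ← hqdef, ← hadef]
  field_simp
  ring

end LinearAlgebra

/-- The Gaussian integral that makes the self-normalized process a martingale. -/
theorem lintegral_exp_quadratic_gaussianReal {r : NNReal} (hr : r ≠ 0) (a q : ℝ) (hq : 0 ≤ q) :
    ∫⁻ x, ENNReal.ofReal (Real.exp ((2 * a * x + q * x ^ 2 - a ^ 2) / (1 + q) / (2 * r)))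
      ∂(gaussianReal 0 r) = ENNReal.ofReal (Real.sqrt (1 + q)) := by
  have hr' : (0 : ℝ) < r := by positivity
  -- Completing the square: the exponential times the density of variance `r` is `√(1 + q)` times
  -- the Gaussian density with mean `a` and variance `r (1 + q)`.
  set v : NNReal := r * (1 + q).toNNReal with hv
  have hvr : (v : ℝ) = r * (1 + q) := by simp [hv, Real.coe_toNNReal _ (by linarith : 0 ≤ 1 + q)]
  have hv0 : v ≠ 0 := by
    intro h
    rw [h] at hvr
    have : (0 : ℝ) < r * (1 + q) := by positivity
    simp at hvr
    rcases hvr with h | h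
    · exact hr h
    · linarith
  rw [gaussianReal_of_var_ne_zero 0 hr, lintegral_withDensity_eq_lintegral_mul₀ (by fun_prop)
    (by fun_prop)]
  have h1 : ∀ x, (gaussianPDF 0 r * fun x => ENNReal.ofReal
      (Real.exp ((2 * a * x + q * x ^ 2 - a ^ 2) / (1 + q) / (2 * r)))) x =
      ENNReal.ofReal (Real.sqrt (1 + q)) * gaussianPDF a v x := by
    intro x
    simp only [Pi.mul_apply, gaussianPDF]
    rw [← ENNReal.ofReal_mul (gaussianPDFReal_nonneg _ _ _),
      ← ENNReal.ofReal_mul (Real.sqrt_nonneg _)]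
    congr 1
    simp only [gaussianPDFReal]
    rw [hvr, mul_assoc, ← Real.exp_add, ← mul_assoc]
    congr 1
    · rw [show 2 * Real.pi * (r * (1 + q)) = (1 + q) * (2 * Real.pi * r) by ring,
        Real.sqrt_mul (by linarith : 0 ≤ 1 + q)]
      have : Real.sqrt (1 + q) ≠ 0 := by positivity
      field_simp
    · congr 1
      field_simp
      ring
  simp_rw [h1]
  rw [lintegral_const_mul _ (by fun_prop), lintegral_gaussianPDF_eq_one a hv0, mul_one]

/-! ### Maximal inequality for nonnegative supermartingales. -/

section Ville

variable {Ω : Type*} {mΩ : MeasurableSpace Ω} {μ : Measure Ω}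

/-- Ville's maximal inequality on a finite horizon. -/
theorem mul_measure_exists_le_of_supermartingale (ℱ : ℕ → MeasurableSpace Ω) (hmono : Monotone ℱ)
    (hle : ∀ k, ℱ k ≤ mΩ) (N : ℕ → Ω → ENNReal) (hN : ∀ k, Measurable[ℱ k] (N k))
    (hstep : ∀ k (A : Set Ω), MeasurableSet[ℱ k] A → ∫⁻ ω in A, N (k + 1) ω ∂μ ≤ ∫⁻ ω in A, N k ω ∂μ)
    (c : ENNReal) (K : ℕ) :
    c * μ {ω | ∃ k ≤ K, c ≤ N k ω} ≤ ∫⁻ ω, N 0 ω ∂μ := by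
  have hset : ∀ k, MeasurableSet[ℱ k] {ω | ∃ j ≤ k, c ≤ N j ω} := by
    intro k
    have : {ω | ∃ j ≤ k, c ≤ N j ω} = ⋃ j ∈ Finset.range (k + 1), {ω | c ≤ N j ω} := by
      ext ω; simp
    rw [this]
    refine Finset.measurableSet_biUnion _ fun j hj => ?_
    exact hmono (Nat.lt_succ_iff.1 (Finset.mem_range.1 hj)) _
      (hN j (measurableSet_Ici (a := c)))
  have hmeas : ∀ k, Measurable[mΩ] (N k) := fun k => (hN k).mono (hle k) le_rfl
  -- Strengthened induction claim: it keeps the mass not yet stopped, so that the supermartingale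
  -- step can be applied on the complement of the crossing event.
  have main : ∀ k, c * μ {ω | ∃ j ≤ k, c ≤ N j ω} +
      ∫⁻ ω in {ω | ∃ j ≤ k, c ≤ N j ω}ᶜ, N k ω ∂μ ≤ ∫⁻ ω, N 0 ω ∂μ := by
    intro k
    induction k with
    | zero =>
      have h0 := hle 0 _ (hset 0)
      refine le_of_le_of_eq ?_ (lintegral_add_compl (N 0) h0)
      simp only [Nat.le_zero, exists_eq_left]
      refine add_le_add (α := ENNReal) ?_ le_rfl
      rw [← setLIntegral_const]
      exact setLIntegral_mono (hmeas 0) fun ω (hω : c ≤ N 0 ω) => hω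
    | succ k ih =>
      refine le_trans ?_ ih
      set D := {ω | ∃ j ≤ k, c ≤ N j ω} with hD
      set D' := {ω | ∃ j ≤ k + 1, c ≤ N j ω} with hD'
      have hDm := hle _ _ (hset k)
      have hDm' := hle _ _ (hset (k + 1))
      have hsub : D ⊆ D' := fun ω ⟨j, hj, h⟩ => ⟨j, hj.trans k.le_succ, h⟩
      have h1 : μ D' = μ D + μ (D' \ D) := by
        rw [← measure_inter_add_sdiff D' hDm, Set.inter_eq_right.2 hsub]
      have h2 : ∫⁻ ω in Dᶜ, N (k + 1) ω ∂μ =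
          ∫⁻ ω in D' \ D, N (k + 1) ω ∂μ + ∫⁻ ω in D'ᶜ, N (k + 1) ω ∂μ := by
        rw [← lintegral_union hDm'.compl]
        · congr 2
          ext ω
          have := @hsub ω
          simp only [Set.mem_compl_iff, Set.mem_union, Set.mem_sdiff]
          tauto
        · exact Set.disjoint_left.2 fun ω h h' => h' h.1
      -- Outside `D` no crossing occurs up to time `k`, so on `D' \ D` the crossing happens exactly
      -- at time `k + 1`.
      have h3 : c * μ (D' \ D) ≤ ∫⁻ ω in D' \ D, N (k + 1) ω ∂μ := by
        rw [← setLIntegral_const]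
        refine setLIntegral_mono (hmeas _) fun ω hω => ?_
        obtain ⟨⟨j, hj, h⟩, hn⟩ := hω
        rcases Nat.lt_or_ge k j with hjk | hjk
        · rwa [show k + 1 = j by omega]
        · exact absurd ⟨j, hjk, h⟩ hn
      calc c * μ D' + ∫⁻ ω in D'ᶜ, N (k + 1) ω ∂μ
          = c * μ D + (c * μ (D' \ D) + ∫⁻ ω in D'ᶜ, N (k + 1) ω ∂μ) := by
            rw [h1, mul_add, add_assoc]
        _ ≤ c * μ D + (∫⁻ ω in D' \ D, N (k + 1) ω ∂μ + ∫⁻ ω in D'ᶜ, N (k + 1) ω ∂μ) := by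
            gcongr
        _ = c * μ D + ∫⁻ ω in Dᶜ, N (k + 1) ω ∂μ := by rw [h2]
        _ ≤ c * μ D + ∫⁻ ω in Dᶜ, N k ω ∂μ := by
            gcongr 1
            exact hstep k _ (hset k).compl
  exact le_trans le_self_add (main K)

end Ville

/-! ### Freezing a variable, and regrouping independent σ-algebras. -/

section Independence

/-- By independence the joint law of `X` and `η` is a product, and Tonelli applies. This freezing
lemma takes the place of conditional expectations given `m`. -/
theorem lintegral_comp_prod_of_indep {Ω α β : Type*} [MeasurableSpace α] [MeasurableSpace β]
    {m mΩ : MeasurableSpace Ω} {μ : Measure Ω} [IsProbabilityMeasure μ] (hm : m ≤ mΩ) {X : Ω → α}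
    {η : Ω → β} (hX : Measurable[m] X) (hη : Measurable[mΩ] η)
    (hind : Indep m (MeasurableSpace.comap η inferInstance) μ) {f : α × β → ENNReal}
    (hf : Measurable f) :
    ∫⁻ ω, f (X ω, η ω) ∂μ = ∫⁻ ω, ∫⁻ b, f (X ω, b) ∂(μ.map η) ∂μ := by
  have hX' : Measurable[mΩ] X := hX.mono hm le_rfl
  have hI : IndepFun X η μ := by
    rw [IndepFun_iff_Indep]
    exact indep_of_indep_of_le_left hind hX.comap_le
  have hlaw := (indepFun_iff_map_prod_eq_prod_map_map hX'.aemeasurable hη.aemeasurable).1 hI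
  have := Measure.isProbabilityMeasure_map (μ := μ) hη.aemeasurable
  rw [← lintegral_map (f := f) (g := fun ω => (X ω, η ω)) hf (hX'.prodMk hη), hlaw,
    lintegral_prod _ hf.aemeasurable, lintegral_map hf.lintegral_prod_right' hX']

/-- If `a` is independent of `b` and `c` is independent of both, then `a ⊔ c` is independent
of `b`. -/
theorem indep_sup_left_of_indep_sup {Ω : Type*} {a b c mΩ : MeasurableSpace Ω} {μ : Measure Ω}
    [IsProbabilityMeasure μ] (ha : a ≤ mΩ) (hb : b ≤ mΩ) (hc : c ≤ mΩ) (hab : Indep a b μ)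
    (habc : Indep (a ⊔ b) c μ) : Indep (a ⊔ c) b μ := by
  have hgen : a ⊔ c = MeasurableSpace.generateFrom
      (Set.image2 (· ∩ ·) {s | MeasurableSet[a] s} {s | MeasurableSet[c] s}) := by
    apply le_antisymm
    · refine sup_le (fun s hs => ?_) (fun s hs => ?_)
      · exact MeasurableSpace.measurableSet_generateFrom
          ⟨s, hs, Set.univ, MeasurableSet.univ, Set.inter_univ s⟩
      · exact MeasurableSpace.measurableSet_generateFrom
          ⟨Set.univ, MeasurableSet.univ, s, hs, Set.univ_inter s⟩
    · refine MeasurableSpace.generateFrom_le ?_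
      rintro _ ⟨s, hs, t, ht, rfl⟩
      exact MeasurableSet.inter (le_sup_left (a := a) (b := c) s hs)
        (le_sup_right (a := a) (b := c) t ht)
  refine IndepSets.indep (sup_le ha hc) hb ?_ (@MeasurableSpace.isPiSystem_measurableSet Ω b) hgen
    (@MeasurableSpace.generateFrom_measurableSet Ω b).symm ?_
  · rintro _ ⟨s, hs, t, ht, rfl⟩ _ ⟨s', hs', t', ht', rfl⟩ -
    exact ⟨s ∩ s', MeasurableSet.inter hs hs', t ∩ t', MeasurableSet.inter ht ht',
      Set.inter_inter_inter_comm s s' t t'⟩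
  · rw [IndepSets_iff]
    rintro _ v ⟨s, hs, t, ht, rfl⟩ hv
    have hs' : MeasurableSet[a ⊔ b] s := le_sup_left (a := a) (b := b) s hs
    have hv' : MeasurableSet[a ⊔ b] v := le_sup_right (a := a) (b := b) v hv
    rw [Indep_iff] at hab habc
    rw [show s ∩ t ∩ v = (s ∩ v) ∩ t by rw [Set.inter_right_comm],
      habc _ _ (MeasurableSet.inter hs' hv') ht, habc _ _ hs' ht, hab _ _ hs hv]
    ring

end Independence

/-! ### Entrywise measurability of matrix expressions. -/

section Measurability

variable {Ω ι : Type*} [MeasurableSpace Ω] [Fintype ι]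

theorem measurable_dotProduct_mulVec_of_entries {M : Ω → Matrix ι ι ℝ} {x y : Ω → ι → ℝ}
    (hM : ∀ i j, Measurable fun ω => M ω i j) (hx : ∀ i, Measurable fun ω => x ω i)
    (hy : ∀ i, Measurable fun ω => y ω i) : Measurable fun ω => x ω ⬝ᵥ M ω *ᵥ y ω := by
  simp only [dotProduct, Matrix.mulVec]
  exact Finset.measurable_sum _ fun i _ => (hx i).mul
    (Finset.measurable_sum _ fun j _ => (hM i j).mul (hy j))

variable [DecidableEq ι]

theorem measurable_det_of_entries {M : Ω → Matrix ι ι ℝ}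
    (hM : ∀ i j, Measurable fun ω => M ω i j) : Measurable fun ω => (M ω).det := by
  simp only [Matrix.det_apply]
  refine Finset.measurable_sum _ fun σ _ => ?_
  exact (Finset.measurable_prod _ fun i _ => hM (σ i) i).const_smul (Equiv.Perm.sign σ)

/-- Cramer's rule: the entries are quotients of determinants. The formula also covers singular
matrices, where both sides use the convention that the inverse of 0 is 0. -/
theorem measurable_inv_of_entries {M : Ω → Matrix ι ι ℝ}
    (hM : ∀ i j, Measurable fun ω => M ω i j) (i j : ι) : Measurable fun ω => (M ω)⁻¹ i j := by
  simp only [Matrix.inv_def, Ring.inverse_eq_inv', Matrix.smul_apply, smul_eq_mul,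
    Matrix.adjugate_apply]
  refine (measurable_det_of_entries hM).inv.mul (measurable_det_of_entries fun k l => ?_)
  simp only [Matrix.updateRow_apply]
  split_ifs
  · exact measurable_const
  · exact hM k l

end Measurability

/-! ### Method of mixtures and the self-normalized tail bound. -/

section SelfNormalized

variable {ι Ω : Type*}

/-- The noise-weighted sum of the first `k` regressors. -/
def noiseSum (φ : ℕ → ι → ℝ) (η : ℕ → ℝ) (k : ℕ) : ι → ℝ :=
  ∑ i ∈ Finset.range k, η i • φ i

theorem noiseSum_succ (φ : ℕ → ι → ℝ) (η : ℕ → ℝ) (k : ℕ) :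
    noiseSum φ η (k + 1) = noiseSum φ η k + η k • φ k :=
  Finset.sum_range_succ _ _

theorem measurable_noiseSum_apply [MeasurableSpace Ω] {φ : ℕ → Ω → ι → ℝ} {η : ℕ → Ω → ℝ} {k : ℕ}
    (hφ : ∀ l < k, ∀ i, Measurable fun ω => φ l ω i) (hη : ∀ l < k, Measurable (η l)) (i : ι) :
    Measurable fun ω => noiseSum (fun l => φ l ω) (fun l => η l ω) k i := by
  simp only [noiseSum, Finset.sum_apply, Pi.smul_apply, smul_eq_mul]
  exact Finset.measurable_sum _ fun l hl =>
    (hη l (Finset.mem_range.1 hl)).mul (hφ l (Finset.mem_range.1 hl) i)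

variable [DecidableEq ι]

/-- The design matrix of the first `k` regressors. -/
def gram (lam : ℝ) (φ : ℕ → ι → ℝ) (k : ℕ) : Matrix ι ι ℝ :=
  lam • (1 : Matrix ι ι ℝ) + ∑ i ∈ Finset.range k, Matrix.vecMulVec (φ i) (φ i)

theorem gram_succ (lam : ℝ) (φ : ℕ → ι → ℝ) (k : ℕ) :
    gram lam φ (k + 1) = gram lam φ k + Matrix.vecMulVec (φ k) (φ k) := by
  rw [gram, Finset.sum_range_succ, ← add_assoc, gram]

theorem measurable_gram_apply [MeasurableSpace Ω] (lam : ℝ) {φ : ℕ → Ω → ι → ℝ} {k : ℕ}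
    (hφ : ∀ l < k, ∀ i, Measurable fun ω => φ l ω i) (i j : ι) :
    Measurable fun ω => gram lam (fun l => φ l ω) k i j := by
  simp only [gram, Matrix.add_apply, Matrix.sum_apply, Matrix.vecMulVec_apply]
  exact measurable_const.add (Finset.measurable_sum _ fun l hl =>
    (hφ l (Finset.mem_range.1 hl) i).mul (hφ l (Finset.mem_range.1 hl) j))

variable [Fintype ι]

/-- The mixture process `(det (λI) / det V_k)^(1/2) exp (S_kᵀ V_k⁻¹ S_k / (2 r))`. -/
noncomputable def mixtureWeight (lam r : ℝ) (φ : ℕ → ι → ℝ) (η : ℕ → ℝ) (k : ℕ) : ℝ :=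
  Real.sqrt ((lam • (1 : Matrix ι ι ℝ)).det / (gram lam φ k).det) *
    Real.exp (noiseSum φ η k ⬝ᵥ (gram lam φ k)⁻¹ *ᵥ noiseSum φ η k / (2 * r))

theorem posDef_gram {lam : ℝ} (hlam : 0 < lam) (φ : ℕ → ι → ℝ) (k : ℕ) :
    (gram lam φ k).PosDef := by
  induction k with
  | zero => simpa [gram] using Matrix.PosDef.one.smul hlam
  | succ k ih => rw [gram_succ]; exact posDef_add_vecMulVec_self ih _

theorem mixtureWeight_zero {lam : ℝ} (hlam : 0 < lam) (r : ℝ) (φ : ℕ → ι → ℝ) (η : ℕ → ℝ) :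
    mixtureWeight lam r φ η 0 = 1 := by
  have h := (posDef_gram hlam φ 0).det_pos
  simp only [gram, Finset.range_zero, Finset.sum_empty, add_zero] at h
  simp only [mixtureWeight, gram, noiseSum, Finset.range_zero, Finset.sum_empty, add_zero,
    div_self h.ne', zero_dotProduct, zero_div, Real.sqrt_one, Real.exp_zero, mul_one]

theorem mixtureWeight_nonneg (lam r : ℝ) (φ : ℕ → ι → ℝ) (η : ℕ → ℝ) (k : ℕ) :
    0 ≤ mixtureWeight lam r φ η k := by
  unfold mixtureWeight; positivity

/-- The rank-one updates of the determinant and of the quadratic form put the new noise `η k` into a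
single factor, which has exactly the shape integrated in `lintegral_exp_quadratic_gaussianReal`. -/
theorem mixtureWeight_succ {lam : ℝ} (hlam : 0 < lam) (r : ℝ) (φ : ℕ → ι → ℝ) (η : ℕ → ℝ)
    (k : ℕ) :
    mixtureWeight lam r φ η (k + 1) = mixtureWeight lam r φ η k *
      (Real.sqrt (1 + φ k ⬝ᵥ (gram lam φ k)⁻¹ *ᵥ φ k))⁻¹ *
      Real.exp ((2 * (φ k ⬝ᵥ (gram lam φ k)⁻¹ *ᵥ noiseSum φ η k) * η k
        + (φ k ⬝ᵥ (gram lam φ k)⁻¹ *ᵥ φ k) * η k ^ 2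
        - (φ k ⬝ᵥ (gram lam φ k)⁻¹ *ᵥ noiseSum φ η k) ^ 2)
        / (1 + φ k ⬝ᵥ (gram lam φ k)⁻¹ *ᵥ φ k) / (2 * r)) := by
  have hV := posDef_gram hlam φ k
  have hq := dotProduct_inv_mulVec_nonneg hV (φ k)
  unfold mixtureWeight
  rw [gram_succ, noiseSum_succ, inv_quadForm_rankOne_update hV, det_add_vecMulVec_self hV,
    add_div, Real.exp_add, div_mul_eq_div_div, Real.sqrt_div' _ (by linarith)]
  ring

theorem measurable_mixtureWeight [MeasurableSpace Ω] (lam r : ℝ) {φ : ℕ → Ω → ι → ℝ}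
    {η : ℕ → Ω → ℝ} {k : ℕ} (hφ : ∀ l < k, ∀ i, Measurable fun ω => φ l ω i)
    (hη : ∀ l < k, Measurable (η l)) :
    Measurable fun ω => mixtureWeight lam r (fun l => φ l ω) (fun l => η l ω) k := by
  have hV := measurable_gram_apply lam hφ
  have hS := measurable_noiseSum_apply hφ hη
  exact (measurable_const.div (measurable_det_of_entries hV)).sqrt.mul
    ((measurable_dotProduct_mulVec_of_entries (measurable_inv_of_entries hV) hS hS).div_const
      _).exp

/-- The martingale property, tested on past events: with the past frozen, the new exponential factor
integrates to `√(1 + q)`, which cancels the normalization. -/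
theorem setLIntegral_mixtureWeight_succ {ℱ : ℕ → MeasurableSpace Ω} {mΩ : MeasurableSpace Ω}
    {μ : Measure Ω} [IsProbabilityMeasure μ] (hmono : Monotone ℱ) (hle : ∀ k, ℱ k ≤ mΩ)
    {φ : ℕ → Ω → ι → ℝ} (hφ : ∀ k i, Measurable[ℱ k] fun ω => φ k ω i) {η : ℕ → Ω → ℝ}
    (hη : ∀ k, Measurable[ℱ (k + 1)] (η k))
    (hind : ∀ k, Indep (ℱ k) (MeasurableSpace.comap (η k) inferInstance) μ) {r : NNReal}
    (hr : r ≠ 0) (hlaw : ∀ k, μ.map (η k) = gaussianReal 0 r) {lam : ℝ} (hlam : 0 < lam) (k : ℕ)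
    {A : Set Ω} (hA : MeasurableSet[ℱ k] A) :
    ∫⁻ ω in A, ENNReal.ofReal
        (mixtureWeight lam r (fun l => φ l ω) (fun l => η l ω) (k + 1)) ∂μ =
      ∫⁻ ω in A, ENNReal.ofReal
        (mixtureWeight lam r (fun l => φ l ω) (fun l => η l ω) k) ∂μ := by
  have hφ' : ∀ l ≤ k, ∀ i, Measurable[ℱ k] fun ω => φ l ω i :=
    fun l hl i => (hφ l i).mono (hmono hl) le_rfl
  have hη' : ∀ l < k, Measurable[ℱ k] (η l) := fun l hl => (hη l).mono (hmono hl) le_rfl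
  have hφ'' : ∀ l < k, ∀ i, Measurable[ℱ k] fun ω => φ l ω i := fun l hl => hφ' l hl.le
  set V : Ω → Matrix ι ι ℝ := fun ω => gram lam (fun l => φ l ω) k with hVdef
  have hV : ∀ i j, Measurable[ℱ k] fun ω => (V ω)⁻¹ i j :=
    @measurable_inv_of_entries _ _ (ℱ k) _ _ _ (@measurable_gram_apply _ _ _ (ℱ k) lam _ _ hφ'')
  have hS := @measurable_noiseSum_apply _ _ (ℱ k) _ _ _ hφ'' hη'
  set a : Ω → ℝ := fun ω => φ k ω ⬝ᵥ (V ω)⁻¹ *ᵥ noiseSum (fun l => φ l ω) (fun l => η l ω) k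
    with hadef
  set q : Ω → ℝ := fun ω => φ k ω ⬝ᵥ (V ω)⁻¹ *ᵥ φ k ω with hqdef
  have ha : Measurable[ℱ k] a :=
    @measurable_dotProduct_mulVec_of_entries _ _ (ℱ k) _ _ _ _ hV (hφ' k le_rfl) hS
  have hq : Measurable[ℱ k] q :=
    @measurable_dotProduct_mulVec_of_entries _ _ (ℱ k) _ _ _ _ hV (hφ' k le_rfl) (hφ' k le_rfl)
  have hq0 : ∀ ω, 0 ≤ q ω := fun ω => dotProduct_inv_mulVec_nonneg (posDef_gram hlam _ k) _
  -- The event is folded into the current weight as an indicator, so that everything except `η k` is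
  -- a function of the past triple `(Z, a, q)`.
  set Z : Ω → ENNReal := A.indicator fun ω => ENNReal.ofReal
    (mixtureWeight lam r (fun l => φ l ω) (fun l => η l ω) k) with hZdef
  have hZ : Measurable[ℱ k] Z :=
    (@measurable_mixtureWeight _ _ _ _ (ℱ k) lam r _ _ _ hφ'' hη').ennreal_ofReal.indicator hA
  set f : (ENNReal × ℝ × ℝ) × ℝ → ENNReal := fun s => s.1.1 *
    ENNReal.ofReal (Real.sqrt (1 + s.1.2.2))⁻¹ * ENNReal.ofReal (Real.exp
      ((2 * s.1.2.1 * s.2 + s.1.2.2 * s.2 ^ 2 - s.1.2.1 ^ 2) / (1 + s.1.2.2) / (2 * r))) with hf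
  have hfm : Measurable f := by fun_prop
  have hX : Measurable[ℱ k] fun ω => (Z ω, a ω, q ω) := hZ.prodMk (ha.prodMk hq)
  rw [← lintegral_indicator (hle k _ hA), ← lintegral_indicator (hle k _ hA)]
  calc ∫⁻ ω, A.indicator (fun ω => ENNReal.ofReal
        (mixtureWeight lam r (fun l => φ l ω) (fun l => η l ω) (k + 1))) ω ∂μ
      = ∫⁻ ω, f ((Z ω, a ω, q ω), η k ω) ∂μ := by
        refine lintegral_congr fun ω => ?_
        by_cases hω : ω ∈ A
        · simp only [hω, Set.indicator_of_mem, hf, hZdef]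
          rw [mixtureWeight_succ hlam, ENNReal.ofReal_mul (by
            have := mixtureWeight_nonneg lam r (fun l => φ l ω) (fun l => η l ω) k
            positivity), ENNReal.ofReal_mul (mixtureWeight_nonneg _ _ _ _ _)]
        · simp [hω, hf, hZdef]
    _ = ∫⁻ ω, ∫⁻ b, f ((Z ω, a ω, q ω), b) ∂(μ.map (η k)) ∂μ :=
        lintegral_comp_prod_of_indep (hle k) hX ((hη k).mono (hle _) le_rfl) (hind k) hfm
    _ = ∫⁻ ω, Z ω ∂μ := by
        refine lintegral_congr fun ω => ?_
        have h0 := hq0 ω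
        simp only [hf]
        rw [hlaw, lintegral_const_mul _ (by fun_prop),
          lintegral_exp_quadratic_gaussianReal hr _ _ h0, mul_assoc,
          ← ENNReal.ofReal_mul (by positivity), inv_mul_cancel₀ (by positivity)]
        simp

/-- Self-normalized tail bound for vector-valued Gaussian noise: the mixture processes of the
coordinates are averaged, so that no union bound over the coordinates is needed. -/
theorem measure_selfNormalized_le {κ : Type*} [Fintype κ] [Nonempty κ] {ℱ : ℕ → MeasurableSpace Ω}
    {mΩ : MeasurableSpace Ω} {μ : Measure Ω} [IsProbabilityMeasure μ] (hmono : Monotone ℱ)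
    (hle : ∀ k, ℱ k ≤ mΩ) {φ : ℕ → Ω → ι → ℝ} (hφ : ∀ k i, Measurable[ℱ k] fun ω => φ k ω i)
    {η : κ → ℕ → Ω → ℝ} (hη : ∀ j k, Measurable[ℱ (k + 1)] (η j k))
    (hind : ∀ j k, Indep (ℱ k) (MeasurableSpace.comap (η j k) inferInstance) μ) {r : κ → NNReal}
    (hr : ∀ j, r j ≠ 0) (hlaw : ∀ j k, μ.map (η j k) = gaussianReal 0 (r j)) {lam : ℝ}
    (hlam : 0 < lam) {δ : ℝ} (hδ : 0 < δ) (K : ℕ) :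
    μ {ω | ∃ k ≤ K, 2 * (Fintype.card κ : ℝ) * Real.log (Real.sqrt (gram lam (fun l => φ l ω) k).det
        / (δ * Real.sqrt (lam • (1 : Matrix ι ι ℝ)).det)) <
      ∑ j, noiseSum (fun l => φ l ω) (fun l => η j l ω) k ⬝ᵥ
        (gram lam (fun l => φ l ω) k)⁻¹ *ᵥ noiseSum (fun l => φ l ω) (fun l => η j l ω) k / r j}
      ≤ ENNReal.ofReal δ := by
  set Z : κ → ℕ → Ω → ℝ := fun j k ω => mixtureWeight lam (r j) (fun l => φ l ω)
    (fun l => η j l ω) k with hZ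
  have hZm : ∀ j k, Measurable[ℱ k] (Z j k) := fun j k =>
    @measurable_mixtureWeight _ _ _ _ (ℱ k) lam (r j) _ _ _
      (fun l hl i => (hφ l i).mono (hmono hl.le) le_rfl)
      (fun l hl => (hη j l).mono (hmono hl) le_rfl)
  have hM : (0 : ℝ) < Fintype.card κ := by exact_mod_cast Fintype.card_pos
  have ville := mul_measure_exists_le_of_supermartingale (μ := μ) ℱ hmono hle
    (fun k ω => ∑ j, ENNReal.ofReal (Z j k ω))
    (fun k => Finset.measurable_sum _ fun j _ => (hZm j k).ennreal_ofReal)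
    (fun k A hA => le_of_eq <| by
      have hm : ∀ k j, Measurable[mΩ] fun ω => ENNReal.ofReal (Z j k ω) :=
        fun k j => ((hZm j k).mono (hle k) le_rfl).ennreal_ofReal
      rw [lintegral_finsetSum _ fun j _ => hm (k + 1) j, lintegral_finsetSum _ fun j _ => hm k j]
      exact Finset.sum_congr rfl fun j _ => setLIntegral_mixtureWeight_succ hmono hle hφ (hη j)
        (hind j) (hr j) (hlaw j) hlam k hA)
    -- The sum of the weights starts at `card κ`, so this level is crossed with probability at most
    -- `δ`.
    (ENNReal.ofReal (Fintype.card κ / δ)) K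
  have h0 : ∫⁻ ω, ∑ j, ENNReal.ofReal (Z j 0 ω) ∂μ = ENNReal.ofReal (Fintype.card κ) := by
    simp [hZ, mixtureWeight_zero hlam]
  rw [h0] at ville
  have hc : ENNReal.ofReal (Fintype.card κ / δ) ≠ 0 := by
    simpa using div_pos hM hδ
  refine le_trans (measure_mono ?_) ((ENNReal.le_div_iff_mul_le (Or.inl hc)
    (Or.inl ENNReal.ofReal_ne_top)).2 (mul_comm _ _ |>.trans_le ville) |>.trans ?_)
  · rintro ω ⟨k, hk, h⟩
    refine ⟨k, hk, ?_⟩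
    rw [← ENNReal.ofReal_sum_of_nonneg fun j _ => mixtureWeight_nonneg _ _ _ _ _]
    refine ENNReal.ofReal_le_ofReal ?_
    have hd := (posDef_gram hlam (fun l => φ l ω) k).det_pos
    have hd0 := (posDef_gram hlam (fun l => φ l ω) 0).det_pos
    simp only [gram, Finset.range_zero, Finset.sum_empty, add_zero] at hd0
    simp only [mixtureWeight]
    set D := (gram lam (fun l => φ l ω) k).det
    set D0 := (lam • (1 : Matrix ι ι ℝ)).det
    set Q : κ → ℝ := fun j => noiseSum (fun l => φ l ω) (fun l => η j l ω) k ⬝ᵥ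
        (gram lam (fun l => φ l ω) k)⁻¹ *ᵥ noiseSum (fun l => φ l ω) (fun l => η j l ω) k
    change 2 * (Fintype.card κ : ℝ) * Real.log (√D / (δ * √D0)) < ∑ j, Q j / r j at h
    change Fintype.card κ / δ ≤ ∑ j, √(D0 / D) * Real.exp (Q j / (2 * r j))
    have hsD : 0 < √D := Real.sqrt_pos.2 hd
    have hsD0 : 0 < √D0 := Real.sqrt_pos.2 hd0
    -- Jensen with uniform weights turns a large average of the exponents into a large average of
    -- the exponentials.
    have jensen := convexOn_exp.map_sum_le (t := Finset.univ)
      (w := fun _ : κ => (Fintype.card κ : ℝ)⁻¹) (p := fun j => Q j / (2 * r j))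
      (fun _ _ => by positivity) (by simp [hM.ne']) (fun _ _ => Set.mem_univ _)
    simp only [smul_eq_mul, ← Finset.mul_sum] at jensen
    have h2 : Real.log (√D / (δ * √D0)) ≤ (Fintype.card κ : ℝ)⁻¹ * ∑ j, Q j / (2 * r j) := by
      have : ∑ j, Q j / (2 * r j) = (∑ j, Q j / r j) / 2 := by
        rw [Finset.sum_div]
        exact Finset.sum_congr rfl fun j _ => by rw [div_div, mul_comm]
      rw [this]
      have := h.le
      field_simp
      linarith
    have h3 := (Real.log_le_iff_le_exp (by positivity)).1 h2
    have h4 := h3.trans jensen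
    rw [← Finset.mul_sum, Real.sqrt_div' _ hd.le]
    have hδ0 : δ ≠ 0 := hδ.ne'
    calc (Fintype.card κ : ℝ) / δ = √D0 / √D * (Fintype.card κ * (√D / (δ * √D0))) := by
          field_simp
      _ ≤ √D0 / √D * (Fintype.card κ * ((Fintype.card κ : ℝ)⁻¹ *
            ∑ j, Real.exp (Q j / (2 * r j)))) := by gcongr
      _ = _ := by field_simp
  · rw [← ENNReal.ofReal_div_of_pos (div_pos hM hδ)]
    refine ENNReal.ofReal_le_ofReal (le_of_eq ?_)
    field_simp

end SelfNormalized

/-! ### Algebra of the Riccati equation. -/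

section Riccati

variable {n m : ℕ} {A : Matrix (Fin n) (Fin n) ℝ} {C : Matrix (Fin m) (Fin n) ℝ} {σw σz : ℝ}
  {Sig : Matrix (Fin n) (Fin n) ℝ}

theorem posDef_innovCov (C : Matrix (Fin m) (Fin n) ℝ) (hσz : 0 < σz) (hSig : Sig.PosSemidef) :
    (innovCov C σz Sig).PosDef := by
  have h1 : (C * Sig * Cᵀ).PosSemidef := by
    simpa [Matrix.conjTranspose_eq_transpose_of_trivial] using hSig.mul_mul_conjTranspose_same C
  exact Matrix.PosDef.posSemidef_add h1 (Matrix.PosDef.one.smul (by positivity))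

theorem kalmanGain_mul_innovCov (A : Matrix (Fin n) (Fin n) ℝ) (C : Matrix (Fin m) (Fin n) ℝ)
    (hσz : 0 < σz) (hSig : Sig.PosSemidef) :
    kalmanGain A C σz Sig * innovCov C σz Sig = A * Sig * Cᵀ := by
  rw [kalmanGain, Matrix.mul_assoc,
    Matrix.nonsing_inv_mul _ (posDef_innovCov C hσz hSig).det_pos.ne'.isUnit, Matrix.mul_one]

/-- The one-step prediction error is uncorrelated with the innovation. -/
theorem Abar_mul_mul_transpose_output (A : Matrix (Fin n) (Fin n) ℝ) (C : Matrix (Fin m) (Fin n) ℝ)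
    (hσz : 0 < σz) (hSig : Sig.PosSemidef) :
    Abar A C σz Sig * Sig * Cᵀ = σz ^ 2 • kalmanGain A C σz Sig := by
  have h := kalmanGain_mul_innovCov A C hσz hSig
  rw [innovCov, Matrix.mul_add, Matrix.mul_smul, Matrix.mul_one] at h
  rw [Abar, Matrix.sub_mul, Matrix.sub_mul, ← h]
  simp only [Matrix.mul_assoc]
  abel

/-- Joseph form of the Riccati equation. -/
theorem joseph_form (hσz : 0 < σz) (hSig : Sig.PosSemidef) (hD : IsDARESolution A C σw σz Sig) :
    Abar A C σz Sig * Sig * (Abar A C σz Sig)ᵀ + σw ^ 2 • (1 : Matrix (Fin n) (Fin n) ℝ)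
      + σz ^ 2 • (kalmanGain A C σz Sig * (kalmanGain A C σz Sig)ᵀ) = Sig := by
  have h := Abar_mul_mul_transpose_output A C hσz hSig
  have e1 : Abar A C σz Sig * Sig * (Abar A C σz Sig)ᵀ = Abar A C σz Sig * Sig * Aᵀ -
      σz ^ 2 • (kalmanGain A C σz Sig * (kalmanGain A C σz Sig)ᵀ) := by
    conv_lhs => rw [show (Abar A C σz Sig)ᵀ = Aᵀ - Cᵀ * (kalmanGain A C σz Sig)ᵀ by
      rw [Abar, Matrix.transpose_sub, Matrix.transpose_mul]]
    rw [Matrix.mul_sub, ← Matrix.mul_assoc, h, Matrix.smul_mul]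
  have e2 : Abar A C σz Sig * Sig * Aᵀ =
      A * Sig * Aᵀ - A * Sig * Cᵀ * (innovCov C σz Sig)⁻¹ * C * Sig * Aᵀ := by
    rw [Abar, kalmanGain, Matrix.sub_mul, Matrix.sub_mul]
  rw [e1, e2]
  conv_rhs => rw [hD]
  abel

theorem dotProduct_mulVec_transpose_mulVec {k l q : ℕ} (M : Matrix (Fin k) (Fin l) ℝ)
    (N : Matrix (Fin q) (Fin l) ℝ) (Q : Matrix (Fin l) (Fin l) ℝ) (u : Fin k → ℝ) (v : Fin q → ℝ) :
    (Mᵀ *ᵥ u) ⬝ᵥ Q *ᵥ (Nᵀ *ᵥ v) = u ⬝ᵥ (M * Q * Nᵀ) *ᵥ v := by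
  rw [Matrix.mulVec_transpose, ← Matrix.dotProduct_mulVec, Matrix.mulVec_mulVec,
    Matrix.mulVec_mulVec, Matrix.mul_assoc]

/-- The covariance of the pair (next prediction error, innovation) is block diagonal. -/
theorem joint_covariance_quadForm (hσz : 0 < σz) (hSig : Sig.PosSemidef)
    (hD : IsDARESolution A C σw σz Sig) (α : Fin n → ℝ) (β : Fin m → ℝ) :
    ((Abar A C σz Sig)ᵀ *ᵥ α + Cᵀ *ᵥ β) ⬝ᵥ Sig *ᵥ ((Abar A C σz Sig)ᵀ *ᵥ α + Cᵀ *ᵥ β)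
      + α ⬝ᵥ (σw ^ 2 • (1 : Matrix (Fin n) (Fin n) ℝ)) *ᵥ α
      + (β - (kalmanGain A C σz Sig)ᵀ *ᵥ α) ⬝ᵥ (σz ^ 2 • (1 : Matrix (Fin m) (Fin m) ℝ)) *ᵥ
        (β - (kalmanGain A C σz Sig)ᵀ *ᵥ α)
      = α ⬝ᵥ Sig *ᵥ α + β ⬝ᵥ innovCov C σz Sig *ᵥ β := by
  set F := kalmanGain A C σz Sig
  set L := Abar A C σz Sig
  -- `h1` cancels the terms mixing `α` and `β`, which is the decorrelation; `h2` collapses the terms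
  -- in `α` alone to `Σ`.
  have h1 : L * Sig * Cᵀ = σz ^ 2 • F := Abar_mul_mul_transpose_output A C hσz hSig
  have h2 : L * Sig * Lᵀ + σw ^ 2 • (1 : Matrix (Fin n) (Fin n) ℝ) + σz ^ 2 • (F * Fᵀ) = Sig :=
    joseph_form hσz hSig hD
  have hsym := dotProduct_mulVec_comm_of_isHermitian hSig.isHermitian (Cᵀ *ᵥ β) (Lᵀ *ᵥ α)
  have e1 := dotProduct_mulVec_transpose_mulVec L C Sig α β
  have e2 := dotProduct_mulVec_transpose_mulVec L L Sig α α
  have e3 := dotProduct_mulVec_transpose_mulVec C C Sig β β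
  have e4 := dotProduct_mulVec_transpose_mulVec F F 1 α α
  have e5 : β ⬝ᵥ (Fᵀ *ᵥ α) = α ⬝ᵥ F *ᵥ β := by
    rw [dotProduct_comm, Matrix.mulVec_transpose, ← Matrix.dotProduct_mulVec]
  have e6 : (Fᵀ *ᵥ α) ⬝ᵥ β = α ⬝ᵥ F *ᵥ β := by
    rw [Matrix.mulVec_transpose, ← Matrix.dotProduct_mulVec]
  have e7 : α ⬝ᵥ Sig *ᵥ α = α ⬝ᵥ (L * Sig * Lᵀ) *ᵥ α + σw ^ 2 * (α ⬝ᵥ α)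
      + σz ^ 2 * (α ⬝ᵥ (F * Fᵀ) *ᵥ α) := by
    conv_lhs => rw [← h2]
    simp only [Matrix.add_mulVec, Matrix.smul_mulVec, Matrix.one_mulVec, dotProduct_add,
      dotProduct_smul, smul_eq_mul]
  have e8 : β ⬝ᵥ innovCov C σz Sig *ᵥ β = β ⬝ᵥ (C * Sig * Cᵀ) *ᵥ β + σz ^ 2 * (β ⬝ᵥ β) := by
    simp only [innovCov, Matrix.add_mulVec, Matrix.smul_mulVec, Matrix.one_mulVec, dotProduct_add,
      dotProduct_smul, smul_eq_mul]
  rw [h1, Matrix.smul_mulVec, dotProduct_smul, smul_eq_mul] at e1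
  rw [Matrix.one_mulVec, Matrix.mul_one] at e4
  rw [e7, e8, ← e2, ← e3, ← e4]
  simp only [Matrix.mulVec_add, dotProduct_add, add_dotProduct, Matrix.smul_mulVec,
    Matrix.one_mulVec, dotProduct_smul, dotProduct_sub, sub_dotProduct, smul_eq_mul]
  rw [hsym, e1, e5, e6]
  ring

end Riccati

/-! ### Joint law of the next error and the innovation. -/

section JointLaw

variable {Ω : Type*} {mΩ : MeasurableSpace Ω} {μ : Measure Ω} {n m : ℕ}

theorem integral_exp_dotProduct_of_hasLaw {k : ℕ} {X : Ω → EuclideanSpace ℝ (Fin k)}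
    {Q : Matrix (Fin k) (Fin k) ℝ} (hQ : Q.PosSemidef)
    (hX : HasLaw X (multivariateGaussian 0 Q) μ) (α : Fin k → ℝ) :
    ∫ ω, Complex.exp (((α ⬝ᵥ (X ω).ofLp : ℝ) : ℂ) * Complex.I) ∂μ =
      Complex.exp (-((α ⬝ᵥ Q *ᵥ α : ℝ) : ℂ) / 2) := by
  have h := charFun_multivariateGaussian (μ := 0) hQ (WithLp.toLp 2 α)
  rw [← hX.map_eq, charFun_apply, integral_map hX.aemeasurable
    (by fun_prop)] at h
  simp only [EuclideanSpace.inner_eq_star_dotProduct, star_trivial, inner_zero_right,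
    Complex.ofReal_zero, zero_mul, zero_sub] at h
  rw [h, neg_div]

variable [IsProbabilityMeasure μ]

theorem hasLaw_multivariateGaussian_of_integral_exp {k : ℕ} {X : Ω → EuclideanSpace ℝ (Fin k)}
    {Q : Matrix (Fin k) (Fin k) ℝ} (hQ : Q.PosSemidef) (hX : AEMeasurable X μ)
    (h : ∀ α : Fin k → ℝ, ∫ ω, Complex.exp (((α ⬝ᵥ (X ω).ofLp : ℝ) : ℂ) * Complex.I) ∂μ =
      Complex.exp (-((α ⬝ᵥ Q *ᵥ α : ℝ) : ℂ) / 2)) :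
    HasLaw X (multivariateGaussian 0 Q) μ := by
  refine ⟨hX, ?_⟩
  have := Measure.isProbabilityMeasure_map hX
  refine Measure.ext_of_charFun ?_
  ext t
  rw [charFun_multivariateGaussian hQ, charFun_apply, integral_map hX (by fun_prop)]
  simp only [EuclideanSpace.inner_eq_star_dotProduct, star_trivial, inner_zero_right,
    Complex.ofReal_zero, zero_mul, zero_sub]
  rw [h, neg_div]

/-- A factorizing joint characteristic function determines a product law, so independence is read
off without constructing a joint Gaussian vector. -/
theorem indepFun_of_integral_exp_eq_mul {X : Ω → EuclideanSpace ℝ (Fin n)}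
    {Y : Ω → EuclideanSpace ℝ (Fin m)} (hX : AEMeasurable X μ) (hY : AEMeasurable Y μ)
    (h : ∀ (α : Fin n → ℝ) (β : Fin m → ℝ),
      ∫ ω, Complex.exp (((α ⬝ᵥ (X ω).ofLp + β ⬝ᵥ (Y ω).ofLp : ℝ) : ℂ) * Complex.I) ∂μ =
        (∫ ω, Complex.exp (((α ⬝ᵥ (X ω).ofLp : ℝ) : ℂ) * Complex.I) ∂μ) *
        ∫ ω, Complex.exp (((β ⬝ᵥ (Y ω).ofLp : ℝ) : ℂ) * Complex.I) ∂μ) : IndepFun X Y μ := by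
  rw [indepFun_iff_charFun_prod hX hY]
  intro t
  rw [charFun_apply, charFun_apply, charFun_apply, integral_map (by fun_prop) (by fun_prop),
    integral_map hX (by fun_prop), integral_map hY (by fun_prop)]
  simpa [WithLp.prod_inner_apply, EuclideanSpace.inner_eq_star_dotProduct] using
    h t.ofLp.1.ofLp t.ofLp.2.ofLp

variable {A : Matrix (Fin n) (Fin n) ℝ} {C : Matrix (Fin m) (Fin n) ℝ} {σw σz : ℝ}
  {Sig : Matrix (Fin n) (Fin n) ℝ} {ε w : Ω → EuclideanSpace ℝ (Fin n)}
  {z : Ω → EuclideanSpace ℝ (Fin m)}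

/-- The next prediction error `Ā ε + w - F z`. -/
noncomputable def nextError (A : Matrix (Fin n) (Fin n) ℝ) (C : Matrix (Fin m) (Fin n) ℝ) (σz : ℝ)
    (Sig : Matrix (Fin n) (Fin n) ℝ) (ε w : EuclideanSpace ℝ (Fin n))
    (z : EuclideanSpace ℝ (Fin m)) : EuclideanSpace ℝ (Fin n) :=
  WithLp.toLp 2 (Abar A C σz Sig *ᵥ ε.ofLp + w.ofLp - kalmanGain A C σz Sig *ᵥ z.ofLp)

/-- The innovation `C ε + z`. -/
noncomputable def innovation (C : Matrix (Fin m) (Fin n) ℝ) (ε : EuclideanSpace ℝ (Fin n))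
    (z : EuclideanSpace ℝ (Fin m)) : EuclideanSpace ℝ (Fin m) :=
  WithLp.toLp 2 (C *ᵥ ε.ofLp + z.ofLp)

theorem measurable_nextError (A : Matrix (Fin n) (Fin n) ℝ) (C : Matrix (Fin m) (Fin n) ℝ)
    (σz : ℝ) (Sig : Matrix (Fin n) (Fin n) ℝ) :
    Measurable fun s : EuclideanSpace ℝ (Fin n) × EuclideanSpace ℝ (Fin n) ×
      EuclideanSpace ℝ (Fin m) => nextError A C σz Sig s.1 s.2.1 s.2.2 := by
  refine Continuous.measurable ?_
  unfold nextError
  fun_prop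

theorem measurable_innovation (C : Matrix (Fin m) (Fin n) ℝ) :
    Measurable fun s : EuclideanSpace ℝ (Fin n) × EuclideanSpace ℝ (Fin m) =>
      innovation C s.1 s.2 := by
  refine Continuous.measurable ?_
  unfold innovation
  fun_prop

-- The exponent is linear in the independent `ε`, `w`, `z`, so the integral splits into three
-- Gaussian characteristic functions. Their quadratic forms recombine by
-- `joint_covariance_quadForm`.
omit [IsProbabilityMeasure μ] in
theorem integral_exp_nextError_innovation (hσz : 0 < σz) (hSig : Sig.PosSemidef)
    (hD : IsDARESolution A C σw σz Sig) (hε : HasLaw ε (multivariateGaussian 0 Sig) μ)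
    (hw : HasLaw w (multivariateGaussian 0 (σw ^ 2 • (1 : Matrix (Fin n) (Fin n) ℝ))) μ)
    (hz : HasLaw z (multivariateGaussian 0 (σz ^ 2 • (1 : Matrix (Fin m) (Fin m) ℝ))) μ)
    (hεwz : IndepFun ε (fun ω => (w ω, z ω)) μ) (hwz : IndepFun w z μ)
    (α : Fin n → ℝ) (β : Fin m → ℝ) :
    ∫ ω, Complex.exp (((α ⬝ᵥ (nextError A C σz Sig (ε ω) (w ω) (z ω)).ofLp +
        β ⬝ᵥ (innovation C (ε ω) (z ω)).ofLp : ℝ) : ℂ) * Complex.I) ∂μ =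
      Complex.exp (-((α ⬝ᵥ Sig *ᵥ α : ℝ) : ℂ) / 2) *
        Complex.exp (-((β ⬝ᵥ innovCov C σz Sig *ᵥ β : ℝ) : ℂ) / 2) := by
  set F := kalmanGain A C σz Sig
  set L := Abar A C σz Sig
  have hsplit : ∀ ω, Complex.exp (((α ⬝ᵥ (nextError A C σz Sig (ε ω) (w ω) (z ω)).ofLp +
        β ⬝ᵥ (innovation C (ε ω) (z ω)).ofLp : ℝ) : ℂ) * Complex.I) =
      Complex.exp ((((Lᵀ *ᵥ α + Cᵀ *ᵥ β) ⬝ᵥ (ε ω).ofLp : ℝ) : ℂ) * Complex.I) *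
      (Complex.exp (((α ⬝ᵥ (w ω).ofLp : ℝ) : ℂ) * Complex.I) *
        Complex.exp ((((β - Fᵀ *ᵥ α) ⬝ᵥ (z ω).ofLp : ℝ) : ℂ) * Complex.I)) := by
    intro ω
    rw [← Complex.exp_add, ← Complex.exp_add, ← add_mul, ← add_mul, ← Complex.ofReal_add,
      ← Complex.ofReal_add]
    congr 3
    simp only [nextError, innovation, dotProduct_add, dotProduct_sub, add_dotProduct,
      sub_dotProduct, Matrix.mulVec_transpose, ← Matrix.dotProduct_mulVec]
    ring
  simp_rw [hsplit]
  rw [hεwz.integral_fun_comp_mul_comp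
      (f := fun e => Complex.exp ((((Lᵀ *ᵥ α + Cᵀ *ᵥ β) ⬝ᵥ e.ofLp : ℝ) : ℂ) * Complex.I))
      (g := fun s => Complex.exp (((α ⬝ᵥ s.1.ofLp : ℝ) : ℂ) * Complex.I) *
        Complex.exp ((((β - Fᵀ *ᵥ α) ⬝ᵥ s.2.ofLp : ℝ) : ℂ) * Complex.I))
      hε.aemeasurable (hw.aemeasurable.prodMk hz.aemeasurable)
      (Continuous.aestronglyMeasurable (by fun_prop))
      (Continuous.aestronglyMeasurable (by fun_prop)),
    hwz.integral_fun_comp_mul_comp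
      (f := fun e => Complex.exp (((α ⬝ᵥ e.ofLp : ℝ) : ℂ) * Complex.I))
      (g := fun e => Complex.exp ((((β - Fᵀ *ᵥ α) ⬝ᵥ e.ofLp : ℝ) : ℂ) * Complex.I))
      hw.aemeasurable hz.aemeasurable
      (Continuous.aestronglyMeasurable (by fun_prop))
      (Continuous.aestronglyMeasurable (by fun_prop)),
    integral_exp_dotProduct_of_hasLaw hSig hε,
    integral_exp_dotProduct_of_hasLaw (Matrix.PosSemidef.one.smul (sq_nonneg σw)) hw,
    integral_exp_dotProduct_of_hasLaw (Matrix.PosSemidef.one.smul (sq_nonneg σz)) hz,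
    ← Complex.exp_add, ← Complex.exp_add, ← Complex.exp_add]
  congr 1
  have h := congrArg (fun s : ℝ => (s : ℂ)) (joint_covariance_quadForm hσz hSig hD α β)
  simp only [Complex.ofReal_add] at h
  linear_combination (-1 / 2 : ℂ) * h

/-- Setting `β` or `α` to zero in the joint characteristic function gives the two marginals, and its
product form then gives independence. -/
theorem nextError_innovation_law (hσz : 0 < σz) (hSig : Sig.PosSemidef)
    (hD : IsDARESolution A C σw σz Sig) (hε : HasLaw ε (multivariateGaussian 0 Sig) μ)
    (hw : HasLaw w (multivariateGaussian 0 (σw ^ 2 • (1 : Matrix (Fin n) (Fin n) ℝ))) μ)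
    (hz : HasLaw z (multivariateGaussian 0 (σz ^ 2 • (1 : Matrix (Fin m) (Fin m) ℝ))) μ)
    (hεwz : IndepFun ε (fun ω => (w ω, z ω)) μ) (hwz : IndepFun w z μ) :
    HasLaw (fun ω => nextError A C σz Sig (ε ω) (w ω) (z ω)) (multivariateGaussian 0 Sig) μ ∧
    HasLaw (fun ω => innovation C (ε ω) (z ω)) (multivariateGaussian 0 (innovCov C σz Sig)) μ ∧
    IndepFun (fun ω => nextError A C σz Sig (ε ω) (w ω) (z ω))
      (fun ω => innovation C (ε ω) (z ω)) μ := by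
  have key := integral_exp_nextError_innovation hσz hSig hD hε hw hz hεwz hwz
  have hεm := hε.aemeasurable
  have hwm := hw.aemeasurable
  have hzm := hz.aemeasurable
  have hX : AEMeasurable (fun ω => nextError A C σz Sig (ε ω) (w ω) (z ω)) μ := by
    have hp : AEMeasurable (fun ω => (ε ω, w ω, z ω)) μ := hεm.prodMk (hwm.prodMk hzm)
    have := (measurable_nextError A C σz Sig).comp_aemeasurable hp
    simpa only [Function.comp_def] using this
  have hY : AEMeasurable (fun ω => innovation C (ε ω) (z ω)) μ := by
    have hp : AEMeasurable (fun ω => (ε ω, z ω)) μ := hεm.prodMk hzm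
    have := (measurable_innovation C).comp_aemeasurable hp
    simpa only [Function.comp_def] using this
  have h1 : ∀ α : Fin n → ℝ, ∫ ω, Complex.exp
      (((α ⬝ᵥ (nextError A C σz Sig (ε ω) (w ω) (z ω)).ofLp : ℝ) : ℂ) * Complex.I) ∂μ =
      Complex.exp (-((α ⬝ᵥ Sig *ᵥ α : ℝ) : ℂ) / 2) := fun α => by
    simpa only [zero_dotProduct, add_zero, Complex.ofReal_zero, neg_zero, zero_div,
      Complex.exp_zero, mul_one] using key α 0
  have h2 : ∀ β : Fin m → ℝ, ∫ ω, Complex.exp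
      (((β ⬝ᵥ (innovation C (ε ω) (z ω)).ofLp : ℝ) : ℂ) * Complex.I) ∂μ =
      Complex.exp (-((β ⬝ᵥ innovCov C σz Sig *ᵥ β : ℝ) : ℂ) / 2) := fun β => by
    simpa only [zero_dotProduct, zero_add, Complex.ofReal_zero, neg_zero, zero_div,
      Complex.exp_zero, one_mul] using key 0 β
  have r1 := hasLaw_multivariateGaussian_of_integral_exp hSig hX h1
  have r2 := hasLaw_multivariateGaussian_of_integral_exp
    (posDef_innovCov C hσz hSig).posSemidef hY h2
  have r3 := indepFun_of_integral_exp_eq_mul hX hY fun α β => by rw [key, h1, h2]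
  exact ⟨r1, r2, r3⟩

end JointLaw

/-! ### Innovations, information and closed-loop data. -/

section Filtering

variable {n m p : ℕ} {A : Matrix (Fin n) (Fin n) ℝ} {B : Matrix (Fin n) (Fin p) ℝ}
  {C : Matrix (Fin m) (Fin n) ℝ} {σw σz : ℝ} {Sig : Matrix (Fin n) (Fin n) ℝ} {Ω : Type*}

/-- The σ-algebra of the agent's randomization and of the first `t` terms of a sequence. -/
@[reducible] def infoSigma (𝒢 : MeasurableSpace Ω) (e : ℕ → Ω → EuclideanSpace ℝ (Fin m)) :
    ℕ → MeasurableSpace Ω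
  | 0 => 𝒢
  | t + 1 => infoSigma 𝒢 e t ⊔ MeasurableSpace.comap (e t) inferInstance

theorem infoSigma_mono (𝒢 : MeasurableSpace Ω) (e : ℕ → Ω → EuclideanSpace ℝ (Fin m)) :
    Monotone (infoSigma 𝒢 e) :=
  monotone_nat_of_le_succ fun _ => le_sup_left

theorem measurable_infoSigma_succ (𝒢 : MeasurableSpace Ω) (e : ℕ → Ω → EuclideanSpace ℝ (Fin m))
    (t : ℕ) : Measurable[infoSigma 𝒢 e (t + 1)] (e t) := by
  rw [measurable_iff_comap_le]
  exact le_sup_right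

theorem infoSigma_le {𝒢 mΩ : MeasurableSpace Ω} {e : ℕ → Ω → EuclideanSpace ℝ (Fin m)} {t : ℕ}
    (h𝒢 : 𝒢 ≤ mΩ) (he : ∀ s < t, Measurable[mΩ] (e s)) : infoSigma 𝒢 e t ≤ mΩ := by
  induction t with
  | zero => exact h𝒢
  | succ t ih =>
    exact sup_le (ih fun s hs => he s (hs.trans t.lt_succ_self)) (he t t.lt_succ_self).comap_le

/-- The sources of randomness that are realized before time `t`. -/
def Source.before (t : ℕ) : Set Source :=
  {i | match i with
    | .agent => True
    | .init => True
    | .process s => s < t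
    | .meas s => s < t}

theorem Source.before_mono : Monotone Source.before := by
  intro s t hst i hi
  cases i with
  | agent => trivial
  | init => trivial
  | process k => exact lt_of_lt_of_le (show k < s from hi) hst
  | meas k => exact lt_of_lt_of_le (show k < s from hi) hst

section Past

variable (𝒢 : MeasurableSpace Ω) (x0 : Ω → EuclideanSpace ℝ (Fin n))
  (w : ℕ → Ω → EuclideanSpace ℝ (Fin n)) (z : ℕ → Ω → EuclideanSpace ℝ (Fin m))

/-- The σ-algebra generated by the sources that are realized before time `t`. -/
@[reducible] def pastSigma (t : ℕ) : MeasurableSpace Ω :=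
  ⨆ i ∈ Source.before t, sourceSigma 𝒢 x0 w z i

theorem pastSigma_mono : Monotone (pastSigma 𝒢 x0 w z) :=
  fun _ _ hst => biSup_mono fun _ hi => Source.before_mono hst hi

theorem sourceSigma_le_pastSigma {t : ℕ} {i : Source} (hi : i ∈ Source.before t) :
    sourceSigma 𝒢 x0 w z i ≤ pastSigma 𝒢 x0 w z t :=
  le_biSup (sourceSigma 𝒢 x0 w z) hi

end Past

theorem measurable_predictionError_pastSigma {𝒢 : MeasurableSpace Ω}
    {ε w : ℕ → Ω → EuclideanSpace ℝ (Fin n)} {z : ℕ → Ω → EuclideanSpace ℝ (Fin m)}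
    (hrec : ∀ t ω, ε (t + 1) ω = nextError A C σz Sig (ε t ω) (w t ω) (z t ω)) (t : ℕ) :
    Measurable[pastSigma 𝒢 (ε 0) w z t] (ε t) := by
  induction t with
  | zero =>
    rw [measurable_iff_comap_le]
    exact sourceSigma_le_pastSigma 𝒢 (ε 0) w z (i := .init) trivial
  | succ t ih =>
    have h1 := ih.mono (pastSigma_mono 𝒢 (ε 0) w z t.le_succ) le_rfl
    have h2 : Measurable[pastSigma 𝒢 (ε 0) w z (t + 1)] (w t) := by
      rw [measurable_iff_comap_le]
      exact sourceSigma_le_pastSigma 𝒢 (ε 0) w z (i := .process t) t.lt_succ_self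
    have h3 : Measurable[pastSigma 𝒢 (ε 0) w z (t + 1)] (z t) := by
      rw [measurable_iff_comap_le]
      exact sourceSigma_le_pastSigma 𝒢 (ε 0) w z (i := .meas t) t.lt_succ_self
    have h4 := (measurable_nextError A C σz Sig).comp (h1.prodMk (h2.prodMk h3))
    simpa only [Function.comp_def, ← hrec] using h4

/-- This transfers independence from the primitive sources to the innovations: the noises at time
`t` are independent of the larger σ-algebra. -/
theorem infoSigma_innovation_le_pastSigma {𝒢 : MeasurableSpace Ω}
    {ε w : ℕ → Ω → EuclideanSpace ℝ (Fin n)} {z : ℕ → Ω → EuclideanSpace ℝ (Fin m)}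
    (hrec : ∀ t ω, ε (t + 1) ω = nextError A C σz Sig (ε t ω) (w t ω) (z t ω)) (t : ℕ) :
    infoSigma 𝒢 (fun s ω => innovation C (ε s ω) (z s ω)) t ≤ pastSigma 𝒢 (ε 0) w z t := by
  refine infoSigma_le (sourceSigma_le_pastSigma 𝒢 (ε 0) w z (i := .agent) trivial) fun s hs => ?_
  have h1 := (measurable_predictionError_pastSigma (𝒢 := 𝒢) hrec s).mono
    (pastSigma_mono 𝒢 (ε 0) w z hs.le) le_rfl
  have h3 : Measurable[pastSigma 𝒢 (ε 0) w z t] (z s) := by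
    rw [measurable_iff_comap_le]
    exact sourceSigma_le_pastSigma 𝒢 (ε 0) w z (i := .meas s) hs
  have h4 := (measurable_innovation C).comp (h1.prodMk h3)
  simpa only [Function.comp_def] using h4

/-- Data of the prediction error recursion driven by independent Gaussian noises. -/
structure IsErrorRecursion (𝒢 : MeasurableSpace Ω) {mΩ : MeasurableSpace Ω} (μ : Measure Ω)
    (A : Matrix (Fin n) (Fin n) ℝ) (C : Matrix (Fin m) (Fin n) ℝ) (σw σz : ℝ)
    (Sig : Matrix (Fin n) (Fin n) ℝ) (ε w : ℕ → Ω → EuclideanSpace ℝ (Fin n))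
    (z : ℕ → Ω → EuclideanSpace ℝ (Fin m)) : Prop where
  agent_le : 𝒢 ≤ mΩ
  measurable_init : Measurable[mΩ] (ε 0)
  measurable_process : ∀ t, Measurable[mΩ] (w t)
  measurable_meas : ∀ t, Measurable[mΩ] (z t)
  law_init : HasLaw (ε 0) (multivariateGaussian 0 Sig) μ
  law_process : ∀ t, HasLaw (w t)
    (multivariateGaussian 0 (σw ^ 2 • (1 : Matrix (Fin n) (Fin n) ℝ))) μ
  law_meas : ∀ t, HasLaw (z t)
    (multivariateGaussian 0 (σz ^ 2 • (1 : Matrix (Fin m) (Fin m) ℝ))) μ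
  indep : iIndep (sourceSigma 𝒢 (ε 0) w z) μ
  error_eq : ∀ t ω, ε (t + 1) ω = nextError A C σz Sig (ε t ω) (w t ω) (z t ω)

namespace IsErrorRecursion

variable {𝒢 mΩ : MeasurableSpace Ω} {μ : Measure Ω} {ε w : ℕ → Ω → EuclideanSpace ℝ (Fin n)}
  {z : ℕ → Ω → EuclideanSpace ℝ (Fin m)}

theorem sourceSigma_le (h : IsErrorRecursion 𝒢 μ A C σw σz Sig ε w z) (i : Source) :
    sourceSigma 𝒢 (ε 0) w z i ≤ mΩ := by
  cases i with
  | agent => exact h.agent_le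
  | init => exact h.measurable_init.comap_le
  | process t => exact (h.measurable_process t).comap_le
  | meas t => exact (h.measurable_meas t).comap_le

theorem pastSigma_le (h : IsErrorRecursion 𝒢 μ A C σw σz Sig ε w z) (t : ℕ) :
    pastSigma 𝒢 (ε 0) w z t ≤ mΩ :=
  iSup₂_le fun i _ => h.sourceSigma_le i

theorem measurable_error (h : IsErrorRecursion 𝒢 μ A C σw σz Sig ε w z) (t : ℕ) :
    Measurable[mΩ] (ε t) :=
  (measurable_predictionError_pastSigma h.error_eq t).mono (h.pastSigma_le t) le_rfl

theorem measurable_innovation (h : IsErrorRecursion 𝒢 μ A C σw σz Sig ε w z) (t : ℕ) :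
    Measurable[mΩ] fun ω => innovation C (ε t ω) (z t ω) := by
  have h4 := (PredictorLS.measurable_innovation C).comp
    ((h.measurable_error t).prodMk (h.measurable_meas t))
  simpa only [Function.comp_def] using h4

theorem infoSigma_le (h : IsErrorRecursion 𝒢 μ A C σw σz Sig ε w z) (t : ℕ) :
    infoSigma 𝒢 (fun s ω => innovation C (ε s ω) (z s ω)) t ≤ mΩ :=
  (infoSigma_innovation_le_pastSigma h.error_eq t).trans (h.pastSigma_le t)

theorem indep_pastSigma (h : IsErrorRecursion 𝒢 μ A C σw σz Sig ε w z) (t : ℕ) :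
    Indep (pastSigma 𝒢 (ε 0) w z t)
      (MeasurableSpace.comap (fun ω => (w t ω, z t ω)) inferInstance) μ := by
  refine indep_of_indep_of_le_right (indep_iSup_of_disjoint h.sourceSigma_le h.indep
    (S := Source.before t) (T := {.process t, .meas t}) ?_) ?_
  · rw [Set.disjoint_right]
    rintro i (rfl | rfl) hi
    · exact lt_irrefl t hi
    · exact lt_irrefl t hi
  · rw [← measurable_iff_comap_le]
    refine Measurable.prodMk ?_ ?_
    · rw [measurable_iff_comap_le]
      exact le_biSup (sourceSigma 𝒢 (ε 0) w z) (Set.mem_insert (Source.process t) {Source.meas t})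
    · rw [measurable_iff_comap_le]
      exact le_biSup (sourceSigma 𝒢 (ε 0) w z)
        (Set.mem_insert_of_mem (Source.process t) (Set.mem_singleton (Source.meas t)))

variable [IsProbabilityMeasure μ]

/-- One step of the steady-state Kalman filter. -/
theorem kalman_step (h : IsErrorRecursion 𝒢 μ A C σw σz Sig ε w z) (hσz : 0 < σz)
    (hSig : Sig.PosSemidef) (hD : IsDARESolution A C σw σz Sig) {t : ℕ}
    (hlaw : HasLaw (ε t) (multivariateGaussian 0 Sig) μ)
    (hind : Indep (MeasurableSpace.comap (ε t) inferInstance)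
      (infoSigma 𝒢 (fun s ω => innovation C (ε s ω) (z s ω)) t) μ) :
    (HasLaw (ε (t + 1)) (multivariateGaussian 0 Sig) μ ∧
      Indep (MeasurableSpace.comap (ε (t + 1)) inferInstance)
        (infoSigma 𝒢 (fun s ω => innovation C (ε s ω) (z s ω)) (t + 1)) μ) ∧
    HasLaw (fun ω => innovation C (ε t ω) (z t ω)) (multivariateGaussian 0 (innovCov C σz Sig)) μ ∧
    Indep (infoSigma 𝒢 (fun s ω => innovation C (ε s ω) (z s ω)) t)
      (MeasurableSpace.comap (fun ω => innovation C (ε t ω) (z t ω)) inferInstance) μ := by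
  have hεle := (h.measurable_error t).comap_le
  have hWm : Measurable[mΩ] fun ω => (w t ω, z t ω) :=
    (h.measurable_process t).prodMk (h.measurable_meas t)
  have hεp : MeasurableSpace.comap (ε t) inferInstance ≤ pastSigma 𝒢 (ε 0) w z t :=
    (measurable_predictionError_pastSigma h.error_eq t).comap_le
  -- The new noises are independent of the current error and the information together. Regrouping
  -- makes the error and the new noises jointly independent of the information.
  have hI := indep_of_indep_of_le_left (h.indep_pastSigma t)
    (sup_le hεp (infoSigma_innovation_le_pastSigma h.error_eq t))
  have hJ := indep_sup_left_of_indep_sup hεle (h.infoSigma_le t) hWm.comap_le hind hI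
  have hεwz : IndepFun (ε t) (fun ω => (w t ω, z t ω)) μ := by
    rw [IndepFun_iff_Indep]
    exact indep_of_indep_of_le_left (h.indep_pastSigma t) hεp
  have hwz : IndepFun (w t) (z t) μ := by
    rw [IndepFun_iff_Indep]
    exact h.indep.indep (i := .process t) (j := .meas t) (by simp)
  obtain ⟨h1, h2, h3⟩ := nextError_innovation_law hσz hSig hD hlaw (h.law_process t)
    (h.law_meas t) hεwz hwz
  have hfun : (fun ω => nextError A C σz Sig (ε t ω) (w t ω) (z t ω)) = ε (t + 1) :=
    funext fun ω => (h.error_eq t ω).symm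
  rw [hfun] at h1 h3
  set a := MeasurableSpace.comap (ε t) inferInstance ⊔
    MeasurableSpace.comap (fun ω => (w t ω, z t ω)) inferInstance with ha
  have mε : Measurable[a] (ε t) := by
    rw [measurable_iff_comap_le]; exact le_sup_left
  have mW : Measurable[a] fun ω => (w t ω, z t ω) := by
    rw [measurable_iff_comap_le]; exact le_sup_right
  have me : MeasurableSpace.comap (fun ω => innovation C (ε t ω) (z t ω)) inferInstance ≤ a := by
    have h4 := (PredictorLS.measurable_innovation C).comp (mε.prodMk (measurable_snd.comp mW))
    simp only [Function.comp_def] at h4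
    exact h4.comap_le
  have mε' : MeasurableSpace.comap (ε (t + 1)) inferInstance ≤ a := by
    have h4 := (measurable_nextError A C σz Sig).comp (mε.prodMk mW)
    simp only [Function.comp_def, ← h.error_eq] at h4
    exact h4.comap_le
  rw [IndepFun_iff_Indep] at h3
  refine ⟨⟨h1, ?_⟩, h2, (indep_of_indep_of_le_left hJ me).symm⟩
  -- Second regrouping: the next error and the innovation are independent of each other and jointly
  -- independent of the old information, so the next error is independent of the enlarged
  -- information.
  have := indep_sup_left_of_indep_sup (h.measurable_innovation t).comap_le
    (h.measurable_error (t + 1)).comap_le (h.infoSigma_le t) h3.symm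
    (indep_of_indep_of_le_left hJ (sup_le me mε'))
  rw [sup_comm] at this
  exact this.symm

theorem law_error_and_indep (h : IsErrorRecursion 𝒢 μ A C σw σz Sig ε w z) (hσz : 0 < σz)
    (hSig : Sig.PosSemidef) (hD : IsDARESolution A C σw σz Sig) (t : ℕ) :
    HasLaw (ε t) (multivariateGaussian 0 Sig) μ ∧
      Indep (MeasurableSpace.comap (ε t) inferInstance)
        (infoSigma 𝒢 (fun s ω => innovation C (ε s ω) (z s ω)) t) μ := by
  induction t with
  | zero =>
    exact ⟨h.law_init, h.indep.indep (i := .init) (j := .agent) (by simp)⟩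
  | succ t ih => exact (h.kalman_step hσz hSig hD ih.1 ih.2).1

/-- The innovations are Gaussian and independent of the past information. -/
theorem law_innovation_and_indep (h : IsErrorRecursion 𝒢 μ A C σw σz Sig ε w z) (hσz : 0 < σz)
    (hSig : Sig.PosSemidef) (hD : IsDARESolution A C σw σz Sig) (t : ℕ) :
    HasLaw (fun ω => innovation C (ε t ω) (z t ω)) (multivariateGaussian 0 (innovCov C σz Sig)) μ ∧
    Indep (infoSigma 𝒢 (fun s ω => innovation C (ε s ω) (z s ω)) t)
      (MeasurableSpace.comap (fun ω => innovation C (ε t ω) (z t ω)) inferInstance) μ := by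
  have := h.law_error_and_indep hσz hSig hD t
  exact (h.kalman_step hσz hSig hD this.1 this.2).2

end IsErrorRecursion

namespace IsClosedLoopData

variable {𝒢 mΩ : MeasurableSpace Ω} {μ : Measure Ω} {x w : ℕ → Ω → EuclideanSpace ℝ (Fin n)}
  {u : ℕ → Ω → EuclideanSpace ℝ (Fin p)} {y z : ℕ → Ω → EuclideanSpace ℝ (Fin m)}

/-- The error of the predictor state does not depend on the inputs. -/
theorem isErrorRecursion (h : IsClosedLoopData 𝒢 μ A B C σw σz Sig x u y w z) :
    IsErrorRecursion 𝒢 μ A C σw σz Sig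
      (fun t ω => x t ω - predictorState A B C σz Sig (fun i => y i ω) (fun i => u i ω) t) w z := by
  have h0 : (fun ω => x 0 ω - predictorState A B C σz Sig (fun i => y i ω) (fun i => u i ω) 0)
      = x 0 := by
    funext ω; simp [predictorState]
  refine ⟨h.agent_le, ?_, h.measurable_process, h.measurable_meas, ?_, h.law_process, h.law_meas,
    ?_, fun t ω => ?_⟩
  · simpa only [h0] using h.measurable_init
  · simpa only [h0] using h.law_init
  · simpa only [h0] using h.indep
  · ext i
    simp only [h.state_eq, predictorState, nextError, h.output_eq, Abar, PiLp.sub_apply,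
      WithLp.ofLp_sub, Matrix.mulVec_sub, Matrix.sub_mulVec, Matrix.mulVec_add, Pi.add_apply,
      Pi.sub_apply, Matrix.mulVec_mulVec]
    ring

/-- The innovation carries all that `y t` adds to the prediction `C x̂_t`. This is both the
regression model and the reason why outputs can be recovered from innovations. -/
theorem output_eq_add_innovation (h : IsClosedLoopData 𝒢 μ A B C σw σz Sig x u y w z) (t : ℕ)
    (ω : Ω) :
    y t ω = WithLp.toLp 2
      (C *ᵥ (predictorState A B C σz Sig (fun i => y i ω) (fun i => u i ω) t).ofLp +
      (innovation C (x t ω - predictorState A B C σz Sig (fun i => y i ω) (fun i => u i ω) t)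
        (z t ω)).ofLp) := by
  rw [h.output_eq, innovation]
  ext i
  simp only [WithLp.ofLp_sub, Matrix.mulVec_sub, Pi.add_apply, Pi.sub_apply]
  ring

/-- The predictor state and the past data are functions of the past information. -/
theorem measurable_data (h : IsClosedLoopData 𝒢 μ A B C σw σz Sig x u y w z) (t : ℕ) :
    (∀ s < t, Measurable[infoSigma 𝒢 (fun s ω => innovation C (x s ω - predictorState A B C σz Sig
        (fun i => y i ω) (fun i => u i ω) s) (z s ω)) t] (y s)) ∧
    (∀ s < t, Measurable[infoSigma 𝒢 (fun s ω => innovation C (x s ω - predictorState A B C σz Sig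
        (fun i => y i ω) (fun i => u i ω) s) (z s ω)) t] (u s)) ∧
    Measurable[infoSigma 𝒢 (fun s ω => innovation C (x s ω - predictorState A B C σz Sig
        (fun i => y i ω) (fun i => u i ω) s) (z s ω)) t]
      (fun ω => predictorState A B C σz Sig (fun i => y i ω) (fun i => u i ω) t) := by
  set e : ℕ → Ω → EuclideanSpace ℝ (Fin m) := fun s ω => innovation C
    (x s ω - predictorState A B C σz Sig (fun i => y i ω) (fun i => u i ω) s) (z s ω) with he
  induction t with
  | zero => exact ⟨by simp, by simp, measurable_const⟩
  | succ t ih =>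
    obtain ⟨ihy, ihu, ihx⟩ := ih
    have hle := infoSigma_mono 𝒢 e t.le_succ
    have hx := ihx.mono hle le_rfl
    have hyt : Measurable[infoSigma 𝒢 e (t + 1)] (y t) := by
      have hc : Measurable fun s : EuclideanSpace ℝ (Fin n) × EuclideanSpace ℝ (Fin m) =>
          (WithLp.toLp 2 (C *ᵥ s.1.ofLp + s.2.ofLp) : EuclideanSpace ℝ (Fin m)) :=
        Continuous.measurable (by fun_prop)
      have h4 := hc.comp (hx.prodMk (measurable_infoSigma_succ 𝒢 e t))
      simpa only [Function.comp_def, he, ← h.output_eq_add_innovation] using h4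
    have hy : ∀ s < t + 1, Measurable[infoSigma 𝒢 e (t + 1)] (y s) := by
      intro s hs
      rcases Nat.lt_succ_iff_lt_or_eq.1 hs with hs | rfl
      · exact (ihy s hs).mono hle le_rfl
      · exact hyt
    -- The input at time `t` may depend on `y t`, so it is known only at index `t + 1`, once `y t`
    -- has been recovered.
    have hut : Measurable[infoSigma 𝒢 e (t + 1)] (u t) := by
      refine (h.input_causal t).mono (sup_le (infoSigma_mono 𝒢 e (Nat.zero_le _)) ?_) le_rfl
      exact iSup_le fun s => (hy s s.2).comap_le
    refine ⟨hy, fun s hs => ?_, ?_⟩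
    · rcases Nat.lt_succ_iff_lt_or_eq.1 hs with hs | rfl
      · exact (ihu s hs).mono hle le_rfl
      · exact hut
    · have hc : Measurable fun s : EuclideanSpace ℝ (Fin n) × EuclideanSpace ℝ (Fin p) ×
          EuclideanSpace ℝ (Fin m) => (WithLp.toLp 2 (Abar A C σz Sig *ᵥ s.1.ofLp + B *ᵥ s.2.1.ofLp
            + kalmanGain A C σz Sig *ᵥ s.2.2.ofLp) : EuclideanSpace ℝ (Fin n)) :=
        Continuous.measurable (by fun_prop)
      have h4 := hc.comp (hx.prodMk (hut.prodMk hyt))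
      simpa only [Function.comp_def, predictorState] using h4

end IsClosedLoopData

end Filtering

/-! ### Frobenius norm and Cauchy–Schwarz inequalities. -/

section MatrixNorms

variable {ι κ : Type*} [Fintype ι] [Fintype κ]

theorem frobNorm_nonneg (M : Matrix ι κ ℝ) : 0 ≤ frobNorm M := Real.sqrt_nonneg _

theorem frobNorm_sq (M : Matrix ι κ ℝ) : frobNorm M ^ 2 = ∑ i, ∑ j, M i j ^ 2 :=
  Real.sq_sqrt (by positivity)

theorem norm_toLp_sq (v : ι → ℝ) : ‖(WithLp.toLp 2 v : EuclideanSpace ℝ ι)‖ ^ 2 = v ⬝ᵥ v := by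
  rw [EuclideanSpace.norm_sq_eq]
  simp [dotProduct, sq]

theorem norm_toLp_mulVec_le (M : Matrix ι κ ℝ) (v : κ → ℝ) :
    ‖(WithLp.toLp 2 (M *ᵥ v) : EuclideanSpace ℝ ι)‖ ≤
      frobNorm M * ‖(WithLp.toLp 2 v : EuclideanSpace ℝ κ)‖ := by
  have hM := frobNorm_nonneg M
  refine le_of_sq_le_sq ?_ (by positivity)
  rw [mul_pow, norm_toLp_sq, norm_toLp_sq, frobNorm_sq, Finset.sum_mul]
  refine Finset.sum_le_sum fun i _ => ?_
  have h := Finset.sum_mul_sq_le_sq_mul_sq Finset.univ (fun j => M i j) v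
  simpa only [Matrix.mulVec, dotProduct, ← sq] using h

theorem dotProduct_le_norm_mul_norm (u v : ι → ℝ) :
    u ⬝ᵥ v ≤ ‖(WithLp.toLp 2 u : EuclideanSpace ℝ ι)‖ * ‖(WithLp.toLp 2 v : EuclideanSpace ℝ ι)‖ := by
  have h := real_inner_le_norm (WithLp.toLp 2 v : EuclideanSpace ℝ ι) (WithLp.toLp 2 u)
  simpa [EuclideanSpace.inner_eq_star_dotProduct, mul_comm] using h

theorem sum_mul_le_frobNorm_mul_frobNorm (M N : Matrix ι κ ℝ) :
    ∑ i, ∑ j, M i j * N i j ≤ frobNorm M * frobNorm N := by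
  have h := Real.sum_mul_le_sqrt_mul_sqrt (Finset.univ : Finset (ι × κ)) (fun q => M q.1 q.2)
    (fun q => N q.1 q.2)
  simpa only [frobNorm, Fintype.sum_prod_type] using h

/-- Cauchy-Schwarz inequality for the dual norms of a positive definite matrix. -/
theorem dotProduct_le_sqrt_mul_sqrt [DecidableEq ι] {V : Matrix ι ι ℝ} (hV : V.PosDef)
    (x d : ι → ℝ) : x ⬝ᵥ d ≤ √(x ⬝ᵥ V⁻¹ *ᵥ x) * √(d ⬝ᵥ V *ᵥ d) := by
  rw [← Real.sqrt_mul (dotProduct_inv_mulVec_nonneg hV x)]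
  refine Real.le_sqrt_of_sq_le ?_
  -- The form of `V` at `d - t V⁻¹ x` is nonnegative for every `t`; its discriminant gives the
  -- inequality.
  have hquad : ∀ t : ℝ, 0 ≤ (x ⬝ᵥ V⁻¹ *ᵥ x) * (t * t) + (-2 * (x ⬝ᵥ d)) * t + d ⬝ᵥ V *ᵥ d := by
    intro t
    have h := hV.posSemidef.dotProduct_mulVec_nonneg (d - t • (V⁻¹ *ᵥ x))
    have h1 := dotProduct_mulVec_comm_of_isHermitian hV.isHermitian (V⁻¹ *ᵥ x) d
    simp only [star_trivial, Matrix.mulVec_sub, Matrix.mulVec_smul, dotProduct_sub,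
      sub_dotProduct, dotProduct_smul, smul_dotProduct, smul_eq_mul,
      mulVec_inv_cancel_of_posDef hV] at h h1
    rw [h1, dotProduct_comm d x, dotProduct_comm (V⁻¹ *ᵥ x) x] at h
    linarith
  have := discrim_le_zero hquad
  rw [discrim] at this
  nlinarith

end MatrixNorms

/-! ### Deterministic error analysis of regularized least squares. -/

section LeastSquares

variable {m p H : ℕ} {lam : ℝ} {y : ℕ → EuclideanSpace ℝ (Fin m)}
  {u : ℕ → EuclideanSpace ℝ (Fin p)}

/-- The normal equation of regularized least squares, tested against a direction `D`. -/
theorem normal_equation {s : ℕ} (hlam : 0 < lam) {X : Matrix (Fin m) (RegIdx m p H) ℝ}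
    (hX : IsMinOn (rlsLoss H lam y u s) Set.univ X) (D : Matrix (Fin m) (RegIdx m p H) ℝ) :
    lam * ∑ i, ∑ j, X i j * D i j + ∑ l ∈ Finset.Icc H s,
      (X *ᵥ (regressor H y u l).ofLp - (y l).ofLp) ⬝ᵥ (D *ᵥ (regressor H y u l).ofLp) = 0 := by
  set L := lam * ∑ i, ∑ j, X i j * D i j + ∑ l ∈ Finset.Icc H s,
      (X *ᵥ (regressor H y u l).ofLp - (y l).ofLp) ⬝ᵥ (D *ᵥ (regressor H y u l).ofLp) with hL
  set Q := lam * frobNorm D ^ 2 + ∑ l ∈ Finset.Icc H s,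
      (D *ᵥ (regressor H y u l).ofLp) ⬝ᵥ (D *ᵥ (regressor H y u l).ofLp) with hQ
  have hQ0 : 0 ≤ Q := by
    refine add_nonneg (by positivity) (Finset.sum_nonneg fun l _ => ?_)
    rw [← norm_toLp_sq]; positivity
  -- Along the line `X + ε D` the loss is a quadratic polynomial in `ε`. Minimality at `ε = 0`
  -- forces its linear coefficient to vanish, through a discriminant with zero constant term.
  have hexp : ∀ ε : ℝ, rlsLoss H lam y u s (X + ε • D) =
      rlsLoss H lam y u s X + 2 * ε * L + ε ^ 2 * Q := by
    intro ε
    have h1 : frobNorm (X + ε • D) ^ 2 = frobNorm X ^ 2 + 2 * ε * ∑ i, ∑ j, X i j * D i j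
        + ε ^ 2 * frobNorm D ^ 2 := by
      simp only [frobNorm_sq, Finset.mul_sum, ← Finset.sum_add_distrib]
      refine Finset.sum_congr rfl fun i _ => Finset.sum_congr rfl fun j _ => ?_
      simp only [Matrix.add_apply, Matrix.smul_apply, smul_eq_mul]
      ring
    have hn : ∀ (Y : Matrix (Fin m) (RegIdx m p H) ℝ) (l : ℕ),
        ‖y l - WithLp.toLp 2 (Y *ᵥ (regressor H y u l).ofLp)‖ ^ 2 =
        (Y *ᵥ (regressor H y u l).ofLp - (y l).ofLp) ⬝ᵥ
          (Y *ᵥ (regressor H y u l).ofLp - (y l).ofLp) := by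
      intro Y l
      rw [← norm_toLp_sq, norm_sub_rev]
      rfl
    simp only [rlsLoss, h1, hn, hL, hQ]
    have h2 : ∀ l, ((X + ε • D) *ᵥ (regressor H y u l).ofLp - (y l).ofLp) ⬝ᵥ
          ((X + ε • D) *ᵥ (regressor H y u l).ofLp - (y l).ofLp) =
        (X *ᵥ (regressor H y u l).ofLp - (y l).ofLp) ⬝ᵥ
          (X *ᵥ (regressor H y u l).ofLp - (y l).ofLp) +
        2 * ε * ((X *ᵥ (regressor H y u l).ofLp - (y l).ofLp) ⬝ᵥ
          (D *ᵥ (regressor H y u l).ofLp)) +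
        ε ^ 2 * ((D *ᵥ (regressor H y u l).ofLp) ⬝ᵥ (D *ᵥ (regressor H y u l).ofLp)) := by
      intro l
      have h3 : (X + ε • D) *ᵥ (regressor H y u l).ofLp - (y l).ofLp =
          (X *ᵥ (regressor H y u l).ofLp - (y l).ofLp) + ε • (D *ᵥ (regressor H y u l).ofLp) := by
        rw [Matrix.add_mulVec, Matrix.smul_mulVec]
        abel
      rw [h3]
      simp only [dotProduct_add, add_dotProduct, dotProduct_smul, smul_dotProduct, smul_eq_mul]
      rw [dotProduct_comm (D *ᵥ (regressor H y u l).ofLp)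
        (X *ᵥ (regressor H y u l).ofLp - (y l).ofLp)]
      ring
    simp only [h2, Finset.sum_add_distrib, ← Finset.mul_sum]
    ring
  have hpos : ∀ ε : ℝ, 0 ≤ Q * (ε * ε) + 2 * L * ε + 0 := by
    intro ε
    have h := hX (Set.mem_univ (X + ε • D))
    simp only [Set.mem_ofPred_eq, hexp] at h
    linarith
  have := discrim_le_zero hpos
  rw [discrim] at this
  nlinarith

theorem trace_mul_designMatrix_mul_transpose (D : Matrix (Fin m) (RegIdx m p H) ℝ) (t : ℕ) :
    (D * designMatrix H lam y u t * Dᵀ).trace = lam * frobNorm D ^ 2 + ∑ l ∈ Finset.Icc H t,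
      (D *ᵥ (regressor H y u l).ofLp) ⬝ᵥ (D *ᵥ (regressor H y u l).ofLp) := by
  rw [designMatrix, Matrix.mul_add, Matrix.add_mul, Matrix.trace_add, Matrix.mul_smul,
    Matrix.mul_one, Matrix.smul_mul, Matrix.trace_smul, smul_eq_mul, Matrix.mul_sum,
    Matrix.sum_mul, Matrix.trace_sum]
  congr 1
  · rw [frobNorm_sq]
    simp [Matrix.trace, Matrix.mul_apply, sq]
  · refine Finset.sum_congr rfl fun l _ => ?_
    rw [Matrix.mul_vecMulVec, Matrix.vecMulVec_mul, Matrix.vecMul_transpose, Matrix.trace_vecMulVec]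

theorem trace_eq_sum_row_quadForm {ι κ : Type*} [Fintype ι] [Fintype κ] (D : Matrix κ ι ℝ)
    (V : Matrix ι ι ℝ) : (D * V * Dᵀ).trace = ∑ j, D j ⬝ᵥ V *ᵥ D j := by
  simp only [Matrix.trace, Matrix.diag, Matrix.mul_assoc]
  rfl

/-- Shift of the time origin from `H` to 0. The truncated difference is 0 when `t < H`, which
matches the empty sum. -/
theorem designMatrix_eq_gram (t : ℕ) :
    designMatrix H lam y u t = gram lam (fun l => (regressor H y u (H + l)).ofLp) (t + 1 - H) := by
  rw [designMatrix, gram, ← Finset.sum_Ico_eq_sum_range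
    (fun i => Matrix.vecMulVec (regressor H y u i).ofLp (regressor H y u i).ofLp)]
  rfl

/-- Error decomposition of regularized least squares: if the outputs are `G φ + b + e`, with
small `b` and controlled self-normalized noise `e`, then the estimate is close to `G`. -/
theorem trace_le_of_rls {s : ℕ} (hlam : 0 < lam) {X G : Matrix (Fin m) (RegIdx m p H) ℝ}
    (hX : IsMinOn (rlsLoss H lam y u s) Set.univ X) {b e : ℕ → Fin m → ℝ}
    (hy : ∀ l ∈ Finset.Icc H s, (y l).ofLp = G *ᵥ (regressor H y u l).ofLp + b l + e l)
    {S β N : ℝ} (hS : frobNorm G ≤ S) (hβ : 0 ≤ β)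
    (hb : ∑ l ∈ Finset.Icc H s, ‖(WithLp.toLp 2 (b l) : EuclideanSpace ℝ (Fin m))‖ *
      ‖regressor H y u l‖ ≤ β * √lam)
    (hN : ∑ j, noiseSum (fun l => (regressor H y u (H + l)).ofLp) (fun l => e (H + l) j) (s + 1 - H)
      ⬝ᵥ (designMatrix H lam y u s)⁻¹ *ᵥ noiseSum (fun l => (regressor H y u (H + l)).ofLp)
        (fun l => e (H + l) j) (s + 1 - H) ≤ N) {t : ℕ} (hts : t ≤ s) :
    ((X - G) * designMatrix H lam y u t * (X - G)ᵀ).trace ≤ (√N + S * √lam + β) ^ 2 := by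
  have hS0 : 0 ≤ S := (frobNorm_nonneg G).trans hS
  set D := X - G with hD
  have hVs : (designMatrix H lam y u s).PosDef := by
    rw [designMatrix_eq_gram]; exact posDef_gram hlam _ _
  set W := (D * designMatrix H lam y u s * Dᵀ).trace with hW
  have hdot : ∀ v : Fin m → ℝ, 0 ≤ v ⬝ᵥ v := fun v => by rw [← norm_toLp_sq]; positivity
  have hWeq := trace_mul_designMatrix_mul_transpose (lam := lam) (y := y) (u := u) D s
  rw [← hW] at hWeq
  -- Enlarging the design matrix only adds squares, so it suffices to treat `t = s`.
  have hmono : (D * designMatrix H lam y u t * Dᵀ).trace ≤ W := by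
    rw [hWeq, trace_mul_designMatrix_mul_transpose]
    gcongr
    exact fun _ _ _ => hdot _
  refine hmono.trans ?_
  -- The ridge term alone controls `D`. This converts the bias and regularization bounds into
  -- multiples of `√W`.
  have hDW : frobNorm D * √lam ≤ √W := by
    refine Real.le_sqrt_of_sq_le ?_
    rw [mul_pow, Real.sq_sqrt hlam.le, hWeq, mul_comm]
    exact le_add_of_nonneg_right (Finset.sum_nonneg fun l _ => hdot _)
  have hW0 : 0 ≤ W := by
    rw [hWeq]
    exact add_nonneg (by positivity) (Finset.sum_nonneg fun l _ => hdot _)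
  have hnormal := normal_equation hlam hX D
  have hXG : ∀ i j, X i j = G i j + D i j := fun i j => by simp [hD]
  have hsplit : W = ∑ l ∈ Finset.Icc H s, b l ⬝ᵥ (D *ᵥ (regressor H y u l).ofLp)
      + ∑ l ∈ Finset.Icc H s, e l ⬝ᵥ (D *ᵥ (regressor H y u l).ofLp)
      - lam * ∑ i, ∑ j, G i j * D i j := by
    have h1 : ∑ i, ∑ j, X i j * D i j = ∑ i, ∑ j, G i j * D i j + frobNorm D ^ 2 := by
      rw [frobNorm_sq, ← Finset.sum_add_distrib]
      refine Finset.sum_congr rfl fun i _ => ?_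
      rw [← Finset.sum_add_distrib]
      exact Finset.sum_congr rfl fun j _ => by rw [hXG]; ring
    have h2 : ∑ l ∈ Finset.Icc H s, (X *ᵥ (regressor H y u l).ofLp - (y l).ofLp) ⬝ᵥ
          (D *ᵥ (regressor H y u l).ofLp) =
        ∑ l ∈ Finset.Icc H s, (D *ᵥ (regressor H y u l).ofLp) ⬝ᵥ (D *ᵥ (regressor H y u l).ofLp)
        - ∑ l ∈ Finset.Icc H s, b l ⬝ᵥ (D *ᵥ (regressor H y u l).ofLp)
        - ∑ l ∈ Finset.Icc H s, e l ⬝ᵥ (D *ᵥ (regressor H y u l).ofLp) := by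
      rw [← Finset.sum_sub_distrib, ← Finset.sum_sub_distrib]
      refine Finset.sum_congr rfl fun l hl => ?_
      rw [hy l hl, ← sub_dotProduct, ← sub_dotProduct]
      congr 1
      rw [hD, Matrix.sub_mulVec]
      abel
    rw [h1, h2] at hnormal
    rw [hWeq]
    linarith
  have hbias : ∑ l ∈ Finset.Icc H s, b l ⬝ᵥ (D *ᵥ (regressor H y u l).ofLp) ≤ β * √W := by
    calc ∑ l ∈ Finset.Icc H s, b l ⬝ᵥ (D *ᵥ (regressor H y u l).ofLp)
        ≤ ∑ l ∈ Finset.Icc H s, ‖(WithLp.toLp 2 (b l) : EuclideanSpace ℝ (Fin m))‖ *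
            ‖regressor H y u l‖ * frobNorm D := by
          refine Finset.sum_le_sum fun l _ => (dotProduct_le_norm_mul_norm _ _).trans ?_
          rw [mul_assoc]
          gcongr
          rw [mul_comm]
          exact norm_toLp_mulVec_le D _
      _ ≤ β * √lam * frobNorm D := by
          rw [← Finset.sum_mul]
          have := frobNorm_nonneg D
          gcongr
      _ = β * (frobNorm D * √lam) := by ring
      _ ≤ β * √W := by gcongr
  have hnoise : ∑ l ∈ Finset.Icc H s, e l ⬝ᵥ (D *ᵥ (regressor H y u l).ofLp) ≤ √N * √W := by
    have h1 : ∑ l ∈ Finset.Icc H s, e l ⬝ᵥ (D *ᵥ (regressor H y u l).ofLp) =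
        ∑ j, noiseSum (fun l => (regressor H y u (H + l)).ofLp) (fun l => e (H + l) j) (s + 1 - H)
          ⬝ᵥ D j := by
      have h2 : ∑ l ∈ Finset.Icc H s, e l ⬝ᵥ (D *ᵥ (regressor H y u l).ofLp) =
          ∑ l ∈ Finset.range (s + 1 - H),
            e (H + l) ⬝ᵥ (D *ᵥ (regressor H y u (H + l)).ofLp) := by
        rw [← Finset.sum_Ico_eq_sum_range (fun l => e l ⬝ᵥ (D *ᵥ (regressor H y u l).ofLp))]
        rfl
      rw [h2]
      simp only [noiseSum, sum_dotProduct, smul_dotProduct, smul_eq_mul]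
      rw [Finset.sum_comm]
      refine Finset.sum_congr rfl fun l _ => ?_
      simp only [dotProduct, Matrix.mulVec]
      refine Finset.sum_congr rfl fun j _ => ?_
      congr 1
      exact Finset.sum_congr rfl fun i _ => mul_comm _ _
    rw [h1]
    calc _ ≤ ∑ j, √(noiseSum (fun l => (regressor H y u (H + l)).ofLp) (fun l => e (H + l) j)
            (s + 1 - H) ⬝ᵥ (designMatrix H lam y u s)⁻¹ *ᵥ
            noiseSum (fun l => (regressor H y u (H + l)).ofLp) (fun l => e (H + l) j)
            (s + 1 - H)) * √(D j ⬝ᵥ designMatrix H lam y u s *ᵥ D j) :=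
          Finset.sum_le_sum fun j _ => dotProduct_le_sqrt_mul_sqrt hVs _ _
      _ ≤ √(∑ j, noiseSum (fun l => (regressor H y u (H + l)).ofLp) (fun l => e (H + l) j)
            (s + 1 - H) ⬝ᵥ (designMatrix H lam y u s)⁻¹ *ᵥ
            noiseSum (fun l => (regressor H y u (H + l)).ofLp) (fun l => e (H + l) j)
            (s + 1 - H)) * √(∑ j, D j ⬝ᵥ designMatrix H lam y u s *ᵥ D j) :=
          Real.sum_sqrt_mul_sqrt_le _ (fun j => dotProduct_inv_mulVec_nonneg hVs _)
            (fun j => by simpa using hVs.posSemidef.dotProduct_mulVec_nonneg (D j))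
      _ ≤ √N * √W := by
          rw [← trace_eq_sum_row_quadForm, ← hW]
          gcongr
  have hreg : -(lam * ∑ i, ∑ j, G i j * D i j) ≤ S * √lam * √W := by
    have h1 := sum_mul_le_frobNorm_mul_frobNorm (-G) D
    have h2 : frobNorm (-G) = frobNorm G := by simp [frobNorm]
    rw [h2] at h1
    simp only [Matrix.neg_apply, neg_mul, Finset.sum_neg_distrib] at h1
    have hDn := frobNorm_nonneg D
    calc -(lam * ∑ i, ∑ j, G i j * D i j) = lam * -(∑ i, ∑ j, G i j * D i j) := by ring
      _ ≤ lam * (S * frobNorm D) := by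
          gcongr
          exact h1.trans (by gcongr)
      _ = S * √lam * (frobNorm D * √lam) := by
          nth_rewrite 1 [← Real.mul_self_sqrt hlam.le]
          ring
      _ ≤ S * √lam * √W := by gcongr
  -- All three terms carry a factor `√W`, which is divided out below; the case `√W = 0` is separate.
  have hfin : √W * √W ≤ (√N + S * √lam + β) * √W := by
    rw [Real.mul_self_sqrt hW0]
    linarith
  have hM : 0 ≤ √N + S * √lam + β := by positivity
  rw [← Real.sq_sqrt hW0]
  rcases (Real.sqrt_nonneg W).eq_or_lt with h0 | h0
  · calc √W ^ 2 = 0 := by rw [← h0]; norm_num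
      _ ≤ _ := by positivity
  · have := le_of_mul_le_mul_right hfin h0
    gcongr

end LeastSquares

/-! ### Truncated predictor form of the output. -/

section Unrolling

variable {n m p : ℕ} (A : Matrix (Fin n) (Fin n) ℝ) (B : Matrix (Fin n) (Fin p) ℝ)
  (C : Matrix (Fin m) (Fin n) ℝ) (σz : ℝ) (Sig : Matrix (Fin n) (Fin n) ℝ)
  (y : ℕ → EuclideanSpace ℝ (Fin m)) (u : ℕ → EuclideanSpace ℝ (Fin p))

theorem predictorState_unroll {H t : ℕ} (hHt : H ≤ t) :
    (predictorState A B C σz Sig y u t).ofLp =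
      ∑ k ∈ Finset.range H, (Abar A C σz Sig ^ k *ᵥ (kalmanGain A C σz Sig *ᵥ (y (t - 1 - k)).ofLp)
        + Abar A C σz Sig ^ k *ᵥ (B *ᵥ (u (t - 1 - k)).ofLp))
      + Abar A C σz Sig ^ H *ᵥ (predictorState A B C σz Sig y u (t - H)).ofLp := by
  induction H with
  | zero => simp
  | succ H ih =>
    rw [ih (Nat.le_of_succ_le hHt), Finset.sum_range_succ, add_assoc]
    congr 1
    rw [show t - H = (t - (H + 1)) + 1 by omega, show t - 1 - H = t - (H + 1) by omega]
    simp only [predictorState, Matrix.mulVec_add, pow_succ, Matrix.mulVec_mulVec]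
    abel

theorem Gy_mulVec_regressor (H t : ℕ) :
    Gy A B C σz Sig H *ᵥ (regressor H y u t).ofLp = C *ᵥ ∑ k ∈ Finset.range H,
      (Abar A C σz Sig ^ k *ᵥ (kalmanGain A C σz Sig *ᵥ (y (t - 1 - k)).ofLp)
        + Abar A C σz Sig ^ k *ᵥ (B *ᵥ (u (t - 1 - k)).ofLp)) := by
  rw [Matrix.mulVec_sum, Finset.sum_range]
  simp only [Matrix.mulVec_add, Matrix.mulVec_mulVec, Finset.sum_add_distrib, ← Matrix.mul_assoc]
  ext i
  simp only [Matrix.mulVec, dotProduct, Gy, regressor, Fintype.sum_sum_type, Sum.elim_inl,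
    Sum.elim_inr, Fintype.sum_prod_type, Pi.add_apply, Finset.sum_apply]

/-- The predictor form of the output, truncated after `H` lags. -/
theorem mulVec_predictorState_eq {H t : ℕ} (hHt : H ≤ t) :
    C *ᵥ (predictorState A B C σz Sig y u t).ofLp =
      Gy A B C σz Sig H *ᵥ (regressor H y u t).ofLp +
      C *ᵥ (Abar A C σz Sig ^ H *ᵥ (predictorState A B C σz Sig y u (t - H)).ofLp) := by
  rw [predictorState_unroll A B C σz Sig y u hHt, Matrix.mulVec_add, Gy_mulVec_regressor]

end Unrolling

/-! ### Basic properties of the spectral norm. -/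

section SpectralNorm

variable {k : ℕ}

theorem specNorm_nonneg (M : Matrix (Fin k) (Fin k) ℝ) : 0 ≤ specNorm M := norm_nonneg _

theorem norm_toLp_mulVec_le_specNorm (M : Matrix (Fin k) (Fin k) ℝ) (v : Fin k → ℝ) :
    ‖(WithLp.toLp 2 (M *ᵥ v) : EuclideanSpace ℝ (Fin k))‖ ≤
      specNorm M * ‖(WithLp.toLp 2 v : EuclideanSpace ℝ (Fin k))‖ :=
  (Matrix.toEuclideanCLM (𝕜 := ℝ) M).le_opNorm (WithLp.toLp 2 v)

theorem specNorm_transpose (M : Matrix (Fin k) (Fin k) ℝ) : specNorm Mᵀ = specNorm M := by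
  have h : Mᵀ = star M := by
    rw [Matrix.star_eq_conjTranspose, Matrix.conjTranspose_eq_transpose_of_trivial]
  rw [specNorm, h, map_star]
  exact norm_star (Matrix.toEuclideanCLM (𝕜 := ℝ) M)

theorem specNorm_mul_le (M N : Matrix (Fin k) (Fin k) ℝ) :
    specNorm (M * N) ≤ specNorm M * specNorm N := by
  rw [specNorm, map_mul]
  exact norm_mul_le _ _

theorem specNorm_pow_le (M : Matrix (Fin k) (Fin k) ℝ) {l : ℕ} (hl : 0 < l) :
    specNorm (M ^ l) ≤ specNorm M ^ l := by
  rw [specNorm, map_pow]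
  exact norm_pow_le' _ hl

theorem specNorm_le_of_sq_le {M : Matrix (Fin k) (Fin k) ℝ} {c : ℝ} (hc : 0 ≤ c)
    (h : ∀ v : Fin k → ℝ, (M *ᵥ v) ⬝ᵥ (M *ᵥ v) ≤ c ^ 2 * (v ⬝ᵥ v)) : specNorm M ≤ c := by
  refine ContinuousLinearMap.opNorm_le_bound _ hc fun x => ?_
  refine le_of_sq_le_sq ?_ (by positivity)
  have := h x.ofLp
  rw [← norm_toLp_sq, ← norm_toLp_sq, ← mul_pow] at this
  exact this

theorem apply_diag_le_specNorm (M : Matrix (Fin k) (Fin k) ℝ) (j : Fin k) :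
    M j j ≤ specNorm M := by
  have h := (dotProduct_le_norm_mul_norm (Pi.single j 1) (M *ᵥ Pi.single j 1)).trans
    (mul_le_mul_of_nonneg_left (norm_toLp_mulVec_le_specNorm M (Pi.single j 1)) (norm_nonneg _))
  have h1 : ‖(WithLp.toLp 2 (Pi.single j 1) : EuclideanSpace ℝ (Fin k))‖ = 1 := by
    simp
  simpa [h1] using h

end SpectralNorm

/-! ### Stability of the predictor matrix. -/

section Stability

variable {n m : ℕ} {A : Matrix (Fin n) (Fin n) ℝ} {C : Matrix (Fin m) (Fin n) ℝ} {σw σz : ℝ}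
  {Sig : Matrix (Fin n) (Fin n) ℝ}

/-- The Joseph form writes `Σ` as `σ_w² I` plus positive semidefinite terms, so the process noise
alone makes it definite. -/
theorem posDef_of_isDARESolution (hσw : 0 < σw) (hσz : 0 < σz) (hSig : Sig.PosSemidef)
    (hD : IsDARESolution A C σw σz Sig) : Sig.PosDef := by
  rw [← joseph_form hσz hSig hD]
  refine Matrix.PosDef.add_posSemidef (Matrix.PosDef.posSemidef_add ?_
    (Matrix.PosDef.one.smul (by positivity))) ?_
  · simpa [Matrix.conjTranspose_eq_transpose_of_trivial] using
      hSig.mul_mul_conjTranspose_same (Abar A C σz Sig)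
  · refine Matrix.PosSemidef.smul ?_ (by positivity)
    simpa [Matrix.conjTranspose_eq_transpose_of_trivial] using
      Matrix.posSemidef_self_mul_conjTranspose (kalmanGain A C σz Sig)

-- Factor `Σ = Qᵀ Q` and take `P = (Qᵀ)⁻¹`. These whitening coordinates are the ones in which `Ā`
-- contracts.
open scoped MatrixOrder in
theorem exists_mul_mul_transpose_eq_one (hSig : Sig.PosDef) :
    ∃ P : Matrix (Fin n) (Fin n) ℝ, IsUnit P.det ∧ P * Sig * Pᵀ = 1 := by
  obtain ⟨Q, hQ⟩ := CStarAlgebra.nonneg_iff_eq_star_mul_self.1 hSig.posSemidef.nonneg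
  rw [Matrix.star_eq_conjTranspose, Matrix.conjTranspose_eq_transpose_of_trivial] at hQ
  have hdet : IsUnit Q.det := by
    have h := hSig.det_pos
    rw [hQ, Matrix.det_mul, Matrix.det_transpose] at h
    exact (left_ne_zero_of_mul h.ne').isUnit
  have hdet' : IsUnit Qᵀ.det := by rwa [Matrix.det_transpose]
  refine ⟨(Qᵀ)⁻¹, Matrix.isUnit_nonsing_inv_det _ hdet', ?_⟩
  rw [hQ, Matrix.transpose_nonsing_inv, Matrix.transpose_transpose, ← Matrix.mul_assoc,
    Matrix.nonsing_inv_mul _ hdet', Matrix.one_mul, Matrix.mul_nonsing_inv _ hdet]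

/-- The predictor matrix is a strict contraction in suitable coordinates. -/
theorem exists_specNorm_conj_Abar_lt_one (hσw : 0 < σw) (hσz : 0 < σz) (hSig : Sig.PosSemidef)
    (hD : IsDARESolution A C σw σz Sig) :
    ∃ (P : Matrix (Fin n) (Fin n) ℝ) (υ : ℝ), IsUnit P.det ∧ 0 < υ ∧ υ < 1 ∧
      specNorm (P * Abar A C σz Sig * P⁻¹) ≤ υ := by
  obtain ⟨P, hP, hPS⟩ := exists_mul_mul_transpose_eq_one (posDef_of_isDARESolution hσw hσz hSig hD)
  set L := Abar A C σz Sig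
  set F := kalmanGain A C σz Sig
  have hPT : IsUnit Pᵀ.det := by rwa [Matrix.det_transpose]
  have hS : P⁻¹ * (P⁻¹)ᵀ = Sig := by
    have h1 : P⁻¹ * (P * Sig * Pᵀ) * (Pᵀ)⁻¹ = Sig := by
      rw [← Matrix.mul_assoc, ← Matrix.mul_assoc, Matrix.nonsing_inv_mul _ hP, Matrix.one_mul,
        Matrix.mul_assoc, Matrix.mul_nonsing_inv _ hPT, Matrix.mul_one]
    rw [hPS, Matrix.mul_one] at h1
    rw [Matrix.transpose_nonsing_inv, h1]
  set M := P * L * P⁻¹ with hM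
  -- The Joseph form in whitened coordinates: `M Mᵀ` falls short of the identity by at least `σ_w² P
  -- Pᵀ`, which is positive definite.
  have hMM : M * Mᵀ = 1 - σw ^ 2 • (P * Pᵀ) - σz ^ 2 • ((P * F) * (P * F)ᵀ) := by
    have hj : L * Sig * Lᵀ = Sig - σw ^ 2 • (1 : Matrix (Fin n) (Fin n) ℝ) - σz ^ 2 • (F * Fᵀ) := by
      rw [sub_sub, eq_sub_iff_add_eq, ← add_assoc]
      exact joseph_form hσz hSig hD
    have h1 : M * Mᵀ = P * (L * Sig * Lᵀ) * Pᵀ := by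
      rw [← hS, hM]
      simp only [Matrix.transpose_mul, Matrix.mul_assoc]
    rw [h1, hj]
    simp only [Matrix.mul_sub, Matrix.sub_mul, hPS, Matrix.mul_smul, Matrix.smul_mul,
      Matrix.mul_one, Matrix.transpose_mul, Matrix.mul_assoc]
  have hdot : ∀ {q : ℕ} (v : Fin q → ℝ), 0 ≤ v ⬝ᵥ v := fun v => by
    rw [← norm_toLp_sq]; positivity
  have hself : ∀ {q : ℕ} (N : Matrix (Fin n) (Fin q) ℝ) (v : Fin n → ℝ),
      v ⬝ᵥ (N * Nᵀ) *ᵥ v = (Nᵀ *ᵥ v) ⬝ᵥ (Nᵀ *ᵥ v) := by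
    intro q N v
    have h := dotProduct_mulVec_transpose_mulVec N N 1 v v
    rw [Matrix.one_mulVec, Matrix.mul_one] at h
    exact h.symm
  -- An upper bound for the squared norm of `(P⁻¹)ᵀ`; the added 1 keeps it positive, also in
  -- dimension 0.
  set K := frobNorm (P⁻¹)ᵀ ^ 2 + 1 with hK
  have hK0 : 0 < K := by positivity
  have hv : ∀ v : Fin n → ℝ, v ⬝ᵥ v ≤ K * ((Pᵀ *ᵥ v) ⬝ᵥ (Pᵀ *ᵥ v)) := by
    intro v
    have h1 := norm_toLp_mulVec_le (P⁻¹)ᵀ (Pᵀ *ᵥ v)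
    rw [Matrix.mulVec_mulVec, Matrix.transpose_nonsing_inv, Matrix.nonsing_inv_mul _ hPT,
      Matrix.one_mulVec, ← Matrix.transpose_nonsing_inv] at h1
    have h2 := pow_le_pow_left₀ (norm_nonneg _) h1 2
    rw [mul_pow, norm_toLp_sq, norm_toLp_sq] at h2
    have := hdot (Pᵀ *ᵥ v)
    rw [hK]
    linarith
  -- The maximum with `1 / 4` only ensures positivity, since the first entry may be nonpositive.
  set c := max (1 - σw ^ 2 / K) (1 / 4) with hc
  have hc1 : c < 1 := max_lt (by have : 0 < σw ^ 2 / K := by positivity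
                                 linarith) (by norm_num)
  have hc0 : 0 < c := lt_of_lt_of_le (by norm_num) (le_max_right _ _)
  refine ⟨P, √c, hP, Real.sqrt_pos.2 hc0, by rw [Real.sqrt_lt' one_pos]; simpa using hc1, ?_⟩
  rw [← specNorm_transpose]
  refine specNorm_le_of_sq_le (Real.sqrt_nonneg _) fun v => ?_
  rw [Real.sq_sqrt hc0.le, ← hself, hMM]
  simp only [Matrix.sub_mulVec, Matrix.one_mulVec, Matrix.smul_mulVec, dotProduct_sub,
    dotProduct_smul, smul_eq_mul, hself]
  have h1 : (1 - σw ^ 2 / K) * (v ⬝ᵥ v) ≤ c * (v ⬝ᵥ v) :=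
    mul_le_mul_of_nonneg_right (le_max_left _ _) (hdot v)
  have h2 : σw ^ 2 / K * (v ⬝ᵥ v) ≤ σw ^ 2 * ((Pᵀ *ᵥ v) ⬝ᵥ (Pᵀ *ᵥ v)) := by
    calc σw ^ 2 / K * (v ⬝ᵥ v) ≤ σw ^ 2 / K * (K * ((Pᵀ *ᵥ v) ⬝ᵥ (Pᵀ *ᵥ v))) := by
          gcongr
          exact hv v
      _ = _ := by field_simp
  have h3 : 0 ≤ σz ^ 2 * (((P * F)ᵀ *ᵥ v) ⬝ᵥ ((P * F)ᵀ *ᵥ v)) :=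
    mul_nonneg (by positivity) (hdot _)
  linarith

end Stability

/-! ### Truncation bias, confidence bound and noise event. -/

section Main

variable {n m p : ℕ} {A : Matrix (Fin n) (Fin n) ℝ} {B : Matrix (Fin n) (Fin p) ℝ}
  {C : Matrix (Fin m) (Fin n) ℝ} {σw σz : ℝ} {Sig : Matrix (Fin n) (Fin n) ℝ}

/-- Conjugation by `P` turns `Ā^H` into a power of a contraction, at the price of the fixed factors
`‖P‖` and `‖P⁻¹‖`. -/
theorem norm_truncation_le {P : Matrix (Fin n) (Fin n) ℝ} {υ : ℝ} (hP : IsUnit P.det)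
    (h : specNorm (P * Abar A C σz Sig * P⁻¹) ≤ υ) {H : ℕ} (hH : 0 < H) (v : Fin n → ℝ) :
    ‖(WithLp.toLp 2 (C *ᵥ (Abar A C σz Sig ^ H *ᵥ v)) : EuclideanSpace ℝ (Fin m))‖ ≤
      frobNorm C * specNorm P⁻¹ * specNorm P * υ ^ H *
        ‖(WithLp.toLp 2 v : EuclideanSpace ℝ (Fin n))‖ := by
  set L := Abar A C σz Sig
  have hpow : L ^ H = P⁻¹ * (P * L * P⁻¹) ^ H * P := by
    have h1 : ∀ k : ℕ, (P * L * P⁻¹) ^ k = P * L ^ k * P⁻¹ := by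
      intro k
      induction k with
      | zero => simp [Matrix.mul_nonsing_inv _ hP]
      | succ k ih =>
        rw [pow_succ, ih, pow_succ]
        calc P * L ^ k * P⁻¹ * (P * L * P⁻¹) = P * L ^ k * (P⁻¹ * P) * L * P⁻¹ := by
              simp only [Matrix.mul_assoc]
          _ = _ := by rw [Matrix.nonsing_inv_mul _ hP, Matrix.mul_one]; simp only [Matrix.mul_assoc]
    rw [h1, ← Matrix.mul_assoc, ← Matrix.mul_assoc, Matrix.nonsing_inv_mul _ hP, Matrix.one_mul,
      Matrix.mul_assoc, Matrix.nonsing_inv_mul _ hP, Matrix.mul_one]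
  have hspec : specNorm (L ^ H) ≤ specNorm P⁻¹ * υ ^ H * specNorm P := by
    have h0 := specNorm_nonneg P
    have h0' := specNorm_nonneg P⁻¹
    rw [hpow]
    calc _ ≤ specNorm (P⁻¹ * (P * L * P⁻¹) ^ H) * specNorm P := specNorm_mul_le _ _
      _ ≤ specNorm P⁻¹ * specNorm ((P * L * P⁻¹) ^ H) * specNorm P := by
          gcongr; exact specNorm_mul_le _ _
      _ ≤ specNorm P⁻¹ * υ ^ H * specNorm P := by
          gcongr
          exact (specNorm_pow_le _ hH).trans (pow_le_pow_left₀ (specNorm_nonneg _) h H)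
  have hC := frobNorm_nonneg C
  calc _ ≤ frobNorm C * ‖(WithLp.toLp 2 (L ^ H *ᵥ v) : EuclideanSpace ℝ (Fin n))‖ :=
        norm_toLp_mulVec_le _ _
    _ ≤ frobNorm C * ((specNorm P⁻¹ * υ ^ H * specNorm P) *
          ‖(WithLp.toLp 2 v : EuclideanSpace ℝ (Fin n))‖) := by
        gcongr
        exact (norm_toLp_mulVec_le_specNorm _ _).trans
          (mul_le_mul_of_nonneg_right hspec (norm_nonneg _))
    _ = _ := by ring

/-- Exponentiating the lower bound on `H` gives `cH T² √m υ^H ≤ √lam`; the factor `√m ≥ 1` is then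
dropped. -/
theorem mul_sq_mul_pow_le_sqrt {cH lam υ : ℝ} {T H : ℕ} (hcH : 0 < cH) (hlam : 0 < lam)
    (hυ : 0 < υ) (hυ1 : υ < 1) (hm : 0 < m) (hT : 0 < T)
    (h : Real.log (cH * (T : ℝ) ^ 2 * √(m : ℝ) / √lam) / Real.log (1 / υ) ≤ H) :
    cH * (T : ℝ) ^ 2 * υ ^ H ≤ √lam := by
  have hlog : 0 < Real.log (1 / υ) := Real.log_pos (by rw [lt_div_iff₀ hυ]; linarith)
  have hT' : (0 : ℝ) < T := by exact_mod_cast hT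
  have hm' : (1 : ℝ) ≤ m := by exact_mod_cast hm
  have hsm : 1 ≤ √(m : ℝ) := Real.one_le_sqrt.2 hm'
  have hsl : 0 < √lam := Real.sqrt_pos.2 hlam
  rw [div_le_iff₀ hlog, ← Real.log_pow] at h
  have h1 := (Real.log_le_log_iff (by positivity) (by positivity)).1 h
  rw [one_div, inv_pow, div_le_iff₀ hsl, ← div_eq_inv_mul, le_div_iff₀ (by positivity)] at h1
  refine le_trans (mul_le_mul_of_nonneg_right ?_ (by positivity)) h1
  exact le_mul_of_one_le_right (by positivity) hsm

/-- On the event where the self-normalized noise is controlled, the confidence bound holds. -/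
theorem confidence_bound_of_noise_le {T τ H : ℕ} {lam S δ cH Υ 𝒳 υ : ℝ} (hτ : τ ≤ T) (hH : 0 < H)
    (hlam : 0 < lam) (hm : 0 < m) (hσz : 0 < σz) (hSig : Sig.PosSemidef)
    {P : Matrix (Fin n) (Fin n) ℝ} (hP : IsUnit P.det) (hυ : 0 < υ) (hυ1 : υ < 1)
    (hPυ : specNorm (P * Abar A C σz Sig * P⁻¹) ≤ υ) (hcH : 0 < cH)
    (hcH' : frobNorm C * specNorm P⁻¹ * specNorm P * |Υ| * |𝒳| ≤ cH)
    (hHe : Real.log (cH * (T : ℝ) ^ 2 * √(m : ℝ) / √lam) / Real.log (1 / υ) ≤ H)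
    (hS : frobNorm (Gy A B C σz Sig H) ≤ S) {y : ℕ → EuclideanSpace ℝ (Fin m)}
    {u : ℕ → EuclideanSpace ℝ (Fin p)} {e : ℕ → EuclideanSpace ℝ (Fin m)}
    (hy : ∀ t, y t = WithLp.toLp 2
      (C *ᵥ (predictorState A B C σz Sig y u t).ofLp + (e t).ofLp))
    {X : Matrix (Fin m) (RegIdx m p H) ℝ} {s t : ℕ} (hts : t ≤ s) (hsτ : s ≤ τ)
    (hX : IsMinOn (rlsLoss H lam y u s) Set.univ X)
    (hbdd : ∀ t, H ≤ t → t ≤ τ → ‖regressor H y u t‖ ≤ Υ * √(H : ℝ) ∧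
      ‖predictorState A B C σz Sig y u (t - H)‖ ≤ 𝒳)
    (hnoise : ∑ j, noiseSum (fun l => (regressor H y u (H + l)).ofLp)
        (fun l => (e (H + l)).ofLp j) (s + 1 - H) ⬝ᵥ (designMatrix H lam y u s)⁻¹ *ᵥ
        noiseSum (fun l => (regressor H y u (H + l)).ofLp)
        (fun l => (e (H + l)).ofLp j) (s + 1 - H) / innovCov C σz Sig j j ≤
      2 * (m : ℝ) * Real.log (√(designMatrix H lam y u s).det /
        (δ * √(lam • (1 : Matrix (RegIdx m p H) (RegIdx m p H) ℝ)).det))) :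
    ((X - Gy A B C σz Sig H) * designMatrix H lam y u t * (X - Gy A B C σz Sig H)ᵀ).trace ≤
      beta C σz Sig H T lam S δ (designMatrix H lam y u s) s := by
  have hR := posDef_innovCov C hσz hSig
  have hVs : (designMatrix H lam y u s).PosDef := by
    rw [designMatrix_eq_gram]; exact posDef_gram hlam _ _
  rw [beta]
  refine trace_le_of_rls hlam hX (b := fun l => C *ᵥ (Abar A C σz Sig ^ H *ᵥ
    (predictorState A B C σz Sig y u (l - H)).ofLp)) (e := fun l => (e l).ofLp) ?_ hS
    (by positivity) ?_ ?_ hts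
  · intro l hl
    rw [hy l, ← mulVec_predictorState_eq A B C σz Sig y u (Finset.mem_Icc.1 hl).1]
  · have hterm : ∀ l ∈ Finset.Icc H s, ‖(WithLp.toLp 2 (C *ᵥ (Abar A C σz Sig ^ H *ᵥ
        (predictorState A B C σz Sig y u (l - H)).ofLp)) : EuclideanSpace ℝ (Fin m))‖ *
        ‖regressor H y u l‖ ≤ √(H : ℝ) / (T : ℝ) ^ 2 * √lam := by
      intro l hl
      obtain ⟨hl1, hl2⟩ := Finset.mem_Icc.1 hl
      obtain ⟨hφ, hx⟩ := hbdd l hl1 (hl2.trans hsτ)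
      -- Positivity of `T` holds here because `1 ≤ H ≤ l ≤ T`; for `T = 0` the sum is empty.
      have hT : 0 < T := by omega
      have hT' : (0 : ℝ) < T := by exact_mod_cast hT
      have key := mul_sq_mul_pow_le_sqrt hcH hlam hυ hυ1 hm hT hHe
      have hC := frobNorm_nonneg C
      have hP0 := specNorm_nonneg P
      have hP1 := specNorm_nonneg P⁻¹
      calc _ ≤ (frobNorm C * specNorm P⁻¹ * specNorm P * υ ^ H * |𝒳|) * (|Υ| * √(H : ℝ)) := by
            gcongr
            · refine (norm_truncation_le hP hPυ hH _).trans ?_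
              gcongr
              exact hx.trans (le_abs_self _)
            · exact hφ.trans (by gcongr; exact le_abs_self _)
        _ = (frobNorm C * specNorm P⁻¹ * specNorm P * |Υ| * |𝒳|) * υ ^ H * √(H : ℝ) := by ring
        _ ≤ cH * υ ^ H * √(H : ℝ) := by gcongr
        _ = √(H : ℝ) / (T : ℝ) ^ 2 * (cH * (T : ℝ) ^ 2 * υ ^ H) := by field_simp
        _ ≤ √(H : ℝ) / (T : ℝ) ^ 2 * √lam := by gcongr
    refine (Finset.sum_le_card_nsmul _ _ _ hterm).trans ?_
    -- There are `s + 1 - H` terms, at most `s` because `H ≥ 1`.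
    rw [Nat.card_Icc, nsmul_eq_mul, ← mul_assoc, mul_div_assoc]
    gcongr
    omega
  -- The tail bound normalizes each coordinate by its own variance. Every diagonal entry is at most
  -- the spectral norm, which is how that norm enters `beta`.
  · have hlogs : ∀ j, noiseSum (fun l => (regressor H y u (H + l)).ofLp)
        (fun l => (e (H + l)).ofLp j) (s + 1 - H) ⬝ᵥ (designMatrix H lam y u s)⁻¹ *ᵥ
        noiseSum (fun l => (regressor H y u (H + l)).ofLp)
        (fun l => (e (H + l)).ofLp j) (s + 1 - H) ≤ specNorm (innovCov C σz Sig) *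
        (noiseSum (fun l => (regressor H y u (H + l)).ofLp)
        (fun l => (e (H + l)).ofLp j) (s + 1 - H) ⬝ᵥ (designMatrix H lam y u s)⁻¹ *ᵥ
        noiseSum (fun l => (regressor H y u (H + l)).ofLp)
        (fun l => (e (H + l)).ofLp j) (s + 1 - H) / innovCov C σz Sig j j) := by
      intro j
      have hq := dotProduct_inv_mulVec_nonneg hVs (noiseSum
        (fun l => (regressor H y u (H + l)).ofLp) (fun l => (e (H + l)).ofLp j) (s + 1 - H))
      have hj : 0 < innovCov C σz Sig j j := hR.diag_pos
      rw [mul_div_left_comm]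
      exact le_mul_of_one_le_right hq ((one_le_div hj).2 (apply_diag_le_specNorm _ j))
    refine (Finset.sum_le_sum fun j _ => hlogs j).trans ?_
    rw [← Finset.mul_sum]
    refine (mul_le_mul_of_nonneg_left hnoise (specNorm_nonneg _)).trans (le_of_eq ?_)
    ring

/-- The innovations of closed-loop data satisfy the self-normalized tail bound. -/
theorem IsClosedLoopData.measure_noise_gt_le {Ω : Type*} {𝒢 mΩ : MeasurableSpace Ω} {μ : Measure Ω}
    [IsProbabilityMeasure μ] {x w : ℕ → Ω → EuclideanSpace ℝ (Fin n)}
    {u : ℕ → Ω → EuclideanSpace ℝ (Fin p)} {y z : ℕ → Ω → EuclideanSpace ℝ (Fin m)}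
    (h : IsClosedLoopData 𝒢 μ A B C σw σz Sig x u y w z) (hσz : 0 < σz)
    (hSig : Sig.PosSemidef) (hD : IsDARESolution A C σw σz Sig) (hm : 0 < m) {H : ℕ}
    {lam δ : ℝ} (hlam : 0 < lam) (hδ : 0 < δ) (K : ℕ) {e : ℕ → Ω → EuclideanSpace ℝ (Fin m)}
    (he : e = fun s ω => innovation C (x s ω - predictorState A B C σz Sig
        (fun i => y i ω) (fun i => u i ω) s) (z s ω)) :
    μ {ω | ∃ k ≤ K, 2 * (m : ℝ) * Real.log
        (√(gram lam (fun l => (regressor H (fun i => y i ω) (fun i => u i ω) (H + l)).ofLp) k).det /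
        (δ * √(lam • (1 : Matrix (RegIdx m p H) (RegIdx m p H) ℝ)).det)) <
      ∑ j, noiseSum (fun l => (regressor H (fun i => y i ω) (fun i => u i ω) (H + l)).ofLp)
          (fun l => (e (H + l) ω).ofLp j) k ⬝ᵥ
        (gram lam (fun l => (regressor H (fun i => y i ω) (fun i => u i ω) (H + l)).ofLp) k)⁻¹ *ᵥ
        noiseSum (fun l => (regressor H (fun i => y i ω) (fun i => u i ω) (H + l)).ofLp)
          (fun l => (e (H + l) ω).ofLp j) k / innovCov C σz Sig j j}
      ≤ ENNReal.ofReal δ := by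
  have hR := posDef_innovCov C hσz hSig
  have : Nonempty (Fin m) := ⟨⟨0, hm⟩⟩
  have hE := h.isErrorRecursion
  have hlaw : ∀ t, HasLaw (e t) (multivariateGaussian 0 (innovCov C σz Sig)) μ ∧
      Indep (infoSigma 𝒢 e t) (MeasurableSpace.comap (e t) inferInstance) μ := by
    rw [he]
    exact fun t => hE.law_innovation_and_indep hσz hSig hD t
  have hdata : ∀ t, (∀ s < t, Measurable[infoSigma 𝒢 e t] (y s)) ∧
      ∀ s < t, Measurable[infoSigma 𝒢 e t] (u s) := by
    rw [he]
    exact fun t => ⟨(h.measurable_data t).1, (h.measurable_data t).2.1⟩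
  have hle : ∀ t, infoSigma 𝒢 e t ≤ mΩ := by
    rw [he]
    exact fun t => hE.infoSigma_le t
  have heval : ∀ j : Fin m, Measurable fun v : EuclideanSpace ℝ (Fin m) => v.ofLp j :=
    fun j => by fun_prop
  have key := measure_selfNormalized_le (κ := Fin m) (μ := μ) (ℱ := fun k => infoSigma 𝒢 e (H + k))
    (φ := fun k ω => (regressor H (fun i => y i ω) (fun i => u i ω) (H + k)).ofLp)
    (η := fun j k ω => (e (H + k) ω).ofLp j) (r := fun j => (innovCov C σz Sig j j).toNNReal)
    (fun a b hab => infoSigma_mono 𝒢 e (by omega)) (fun k => hle _) ?_ ?_ ?_ ?_ ?_ hlam hδ K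
  · simpa only [Fintype.card_fin, Real.coe_toNNReal _ hR.diag_pos.le] using key
  -- Every lag in the regressor at time `H + k` is at least 1, so its entries belong to the
  -- information at that time.
  · rintro k (⟨i, j⟩ | ⟨i, j⟩)
    · have := (hdata (H + k)).1 (H + k - 1 - i) (by omega)
      exact Measurable.comp (g := fun v : EuclideanSpace ℝ (Fin m) => v.ofLp j) (by fun_prop) this
    · have := (hdata (H + k)).2 (H + k - 1 - i) (by omega)
      exact Measurable.comp (g := fun v : EuclideanSpace ℝ (Fin p) => v.ofLp j) (by fun_prop) this
  · intro j k
    exact (heval j).comp (measurable_infoSigma_succ 𝒢 e (H + k))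
  · intro j k
    refine indep_of_indep_of_le_right (hlaw (H + k)).2 ?_
    rw [← measurable_iff_comap_le]
    exact (heval j).comp (comap_measurable (e (H + k)))
  · intro j
    exact (Real.toNNReal_pos.2 hR.diag_pos).ne'
  · intro j k
    have h1 := (measurePreserving_eval_multivariateGaussian (μ := 0) hR.posSemidef (i := j)).map_eq
    rw [← (hlaw (H + k)).1.map_eq, AEMeasurable.map_map_of_aemeasurable
      (heval j).aemeasurable (hlaw (H + k)).1.aemeasurable] at h1
    exact h1

end Main

end PredictorLS

theorem mainTheorem6 {n m p : ℕ} (A : Matrix (Fin n) (Fin n) ℝ) (B : Matrix (Fin n) (Fin p) ℝ)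
    (C : Matrix (Fin m) (Fin n) ℝ) (σw σz : ℝ) (hσw : 0 < σw) (hσz : 0 < σz)
    (Sig : Matrix (Fin n) (Fin n) ℝ) (hSig : Sig.PosSemidef)
    (hDARE : PredictorLS.IsDARESolution A C σw σz Sig) :
    (∃ (P : Matrix (Fin n) (Fin n) ℝ) (υ : ℝ), IsUnit P.det ∧ 0 < υ ∧ υ < 1 ∧
      PredictorLS.specNorm (P * PredictorLS.Abar A C σz Sig * P⁻¹) ≤ υ) ∧
    ∀ (P : Matrix (Fin n) (Fin n) ℝ) (υ : ℝ), IsUnit P.det → 0 < υ → υ < 1 →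
      PredictorLS.specNorm (P * PredictorLS.Abar A C σz Sig * P⁻¹) ≤ υ →
    ∀ Υ 𝒳 : ℝ, ∃ cH : ℝ, 0 < cH ∧
    ∀ (T τ He : ℕ) (lam S δ : ℝ), τ ≤ T → 0 < He → 0 < lam → 0 < δ → δ < 1 →
      Real.log (cH * (T : ℝ) ^ 2 * Real.sqrt (m : ℝ) / Real.sqrt lam) / Real.log (1 / υ) ≤ He →
      PredictorLS.frobNorm (PredictorLS.Gy A B C σz Sig He) ≤ S →
    ∀ (Ω : Type*) (𝒢 : MeasurableSpace Ω) (mΩ : MeasurableSpace Ω) (μ : Measure Ω)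
      (x : ℕ → Ω → EuclideanSpace ℝ (Fin n)) (u : ℕ → Ω → EuclideanSpace ℝ (Fin p))
      (y : ℕ → Ω → EuclideanSpace ℝ (Fin m)) (w : ℕ → Ω → EuclideanSpace ℝ (Fin n))
      (z : ℕ → Ω → EuclideanSpace ℝ (Fin m))
      (Ghat : ℕ → Ω → Matrix (Fin m) (PredictorLS.RegIdx m p He) ℝ),
      IsProbabilityMeasure μ →
      PredictorLS.IsClosedLoopData 𝒢 μ A B C σw σz Sig x u y w z →
      (∀ s ω, IsMinOn (PredictorLS.rlsLoss He lam (fun i => y i ω) (fun i => u i ω) s)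
        Set.univ (Ghat s ω)) →
      μ {ω |
        (∀ t, He ≤ t → t ≤ τ →
          ‖PredictorLS.regressor He (fun i => y i ω) (fun i => u i ω) t‖ ≤ Υ * Real.sqrt (He : ℝ) ∧
          ‖PredictorLS.predictorState A B C σz Sig (fun i => y i ω) (fun i => u i ω) (t - He)‖
            ≤ 𝒳) ∧
        ¬ ∀ s t, t ≤ s → s ≤ τ →
          ((Ghat s ω - PredictorLS.Gy A B C σz Sig He) *
            PredictorLS.designMatrix He lam (fun i => y i ω) (fun i => u i ω) t *
            (Ghat s ω - PredictorLS.Gy A B C σz Sig He)ᵀ).trace ≤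
          PredictorLS.beta C σz Sig He T lam S δ
            (PredictorLS.designMatrix He lam (fun i => y i ω) (fun i => u i ω) s) s}
      ≤ ENNReal.ofReal δ := by
  refine ⟨PredictorLS.exists_specNorm_conj_Abar_lt_one hσw hσz hSig hDARE, ?_⟩
  intro P υ hP hυ hυ1 hPυ Υ 𝒳
  have hK : 0 ≤ PredictorLS.frobNorm C * PredictorLS.specNorm P⁻¹ * PredictorLS.specNorm P *
      |Υ| * |𝒳| := by
    have h1 := PredictorLS.frobNorm_nonneg C
    have h2 := PredictorLS.specNorm_nonneg P
    have h3 := PredictorLS.specNorm_nonneg P⁻¹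
    positivity
  -- The constant is the coefficient of `υ^H √H` in the truncation bias times the regressor norm;
  -- the added 1 makes it positive.
  refine ⟨PredictorLS.frobNorm C * PredictorLS.specNorm P⁻¹ * PredictorLS.specNorm P *
    |Υ| * |𝒳| + 1, by linarith, ?_⟩
  intro T τ He lam S δ hτ hHe hlam hδ _ hlog hS Ω 𝒢 _ μ x u y w z Ghat hμ hdata hG
  -- Without outputs the trace is an empty sum and `beta` is a square, so the bad event is empty.
  -- The tail bound needs at least one coordinate.
  rcases Nat.eq_zero_or_pos m with rfl | hm
  · refine le_trans (le_of_eq ?_) zero_le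
    convert measure_empty (μ := μ)
    ext ω
    simp only [Set.mem_ofPred_eq, Set.mem_empty_iff_false, iff_false, not_and, not_not]
    intro _ s t _ _
    rw [Matrix.trace, Finset.univ_eq_empty, Finset.sum_empty]
    exact sq_nonneg _
  · refine le_trans (measure_mono ?_)
      -- Time `s` corresponds to `s + 1 - He` regressors, so the horizon `τ + 1` covers every `s ≤
      -- τ`.
      (hdata.measure_noise_gt_le hσz hSig hDARE hm (H := He) hlam hδ (τ + 1) rfl)
    rintro ω ⟨hbdd, hbad⟩
    by_contra hgood
    refine hbad fun s t hts hsτ => ?_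
    simp only [Set.mem_ofPred_eq, not_exists, not_and, not_lt] at hgood
    have hnoise := hgood (s + 1 - He) (by omega)
    rw [← PredictorLS.designMatrix_eq_gram] at hnoise
    exact PredictorLS.confidence_bound_of_noise_le hτ hHe hlam hm hσz hSig hP hυ hυ1 hPυ
      (by linarith) (by linarith) hlog hS (fun t => hdata.output_eq_add_innovation t ω) hts hsτ
      (hG s ω) hbdd hnoise
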